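/- Identify the (not necessarily associative) algebra structures on $\mathbb{C}^5$ with the points $(c_{ij}^k)$ of $\mathbb{C}^{125}$, where $e_ie_j=\sum_k c_{ij}^k e_k$, and equip $\mathbb{C}^{125}$ with the Zariski topology. The group $\mathrm{GL}_5(\mathbb{C})$ acts on it by $(g*\mu)(x,y)=g\mu(g^{-1}x,g^{-1}y)$, and $\mathcal{O}(A)$ denotes the orbit of $A$; for a family $\mathfrak V$ of algebras let $\overline{\{\mathcal O(\mathfrak V)\}}$ be the Zariski closure of the union of the orbits of its members. Let $\mathfrak{Nil}_5^2$ be the variety of complex $5$-dimensional $2$-step nilpotent algebras, that is, of all algebra structures with $(xy)z=x(yz)=0$ for all $x,y,z$. For an algebra $A$ let $A^2$ be the linear span of all products, and $\operatorname{Ann}A=\{x : xA=Ax=0\}$. Consider the following families (products of basis vectors that are not listed are zero, and all parameters range over $\mathbb{C}$): * $\mathfrak V_{2+3}=\{A_{133}(\lambda)\}$: $e_1e_1=e_3+\lambda e_5$, $e_1e_2=e_3$, $e_2e_1=e_4$, $e_2e_2=e_5$. * $\mathfrak V_{3+2}$: $e_ie_j=a_{ij}e_4+b_{ij}e_5$ for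 $1\le i,j\le 3$, where $$(a_{ij})=\begin{pmatrix}1&0&0\\0&0&1\\0&\lambda&0\end{pmatrix},\qquad (b_{ij})=\begin{pmatrix}0&\mu_1&\mu_2\\ \mu_3&\mu_4&\mu_5\\ \mu_6&\mu_7&1\end{pmatrix}.$$ * $\mathfrak V_{4+1}$: $e_1e_2=e_5$, $e_2e_1=\lambda e_5$, $e_3e_4=e_5$, $e_4e_3=\mu e_5$. **Theorem B.** The variety $\mathfrak{Nil}_5^2$ has dimension $24$, and it has exactly $3$ irreducible components, namely $$\mathcal C_1=\overline{\{\mathcal O(\mathfrak V_{2+3})\}},\quad \mathcal C_2=\overline{\{\mathcal O(\mathfrak V_{3+2})\}},\quad \mathcal C_3=\overline{\{\mathcal O(\mathfrak V_{4+1})\}}.$$ They correspond to $\dim A^2=3,2,1$ respectively: for $(\mathcal C,\mathfrak V,k)=(\mathcal C_1,\mathfrak V_{2+3},3)$, $(\mathcal C_2,\mathfrak V_{3+2},2)$, $(\mathcal C_3,\mathfrak V_{4+1},1)$, every member $A$ of $\mathfrak V$ has $\dim A^2=k$, and $\mathcal C$ is the Zariski closure of $\{A\in\mathfrak{Nil}_5^2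 : \dim A^2=k\}$ and is equal to $\{A\in\mathfrak{Nil}_5^2 : \dim A^2\le k\le\dim\operatorname{Ann}A\}$. -/

import Mathlib

namespace TwoStepNilpotent

/-- The underlying vector space `ℂⁿ`. -/
abbrev Vec (n : ℕ) : Type := Fin n → ℂ

/-- The affine space `ℂ^(n³)` of all (not necessarily associative) algebra structures on `ℂⁿ`,
given by structure constants: `c (i, j, k)` is the coefficient of `e_k` in `e_i e_j`.
It is a type synonym, so that it can carry the Zariski topology. -/
def AlgStr (n : ℕ) : Type := Fin n × Fin n × Fin n → ℂ

/-- The common zero set in the affine space of structure constants of a set of polynomials. -/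
def zeros {n : ℕ} (S : Set (MvPolynomial (Fin n × Fin n × Fin n) ℂ)) : Set (AlgStr n) :=
  {c | ∀ p ∈ S, MvPolynomial.eval (fun t => c t) p = 0}

/-- The Zariski topology on the affine space of structure constants: the closed sets are the
sets that are defined by polynomial equations. -/
instance zariskiTopology (n : ℕ) : TopologicalSpace (AlgStr n) :=
  TopologicalSpace.ofClosed (Set.range zeros)
    ⟨{1}, by ext c; simp [zeros]⟩
    (by
      intro A hA
      refine ⟨⋃ S ∈ {S | zeros S ∈ A}, S, ?_⟩
      ext c
      simp only [zeros, Set.mem_ofPred_eq, Set.mem_iUnion, Set.mem_sInter]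
      constructor
      · intro h Z hZ
        obtain ⟨S, rfl⟩ := hA hZ
        exact fun p hp => h p ⟨S, hZ, hp⟩
      · rintro h p ⟨S, hS, hp⟩
        exact h _ hS p hp)
    (by
      rintro _ ⟨S, rfl⟩ _ ⟨T, rfl⟩
      refine ⟨{r | ∃ p ∈ S, ∃ q ∈ T, r = p * q}, ?_⟩
      ext c
      simp only [zeros, Set.mem_union, Set.mem_ofPred_eq]
      constructor
      · intro h
        by_contra! hc
        obtain ⟨⟨p, hp, hp0⟩, ⟨q, hq, hq0⟩⟩ := hc
        have := h (p * q) ⟨p, hp, q, hq, rfl⟩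
        rw [map_mul] at this
        exact (mul_ne_zero hp0 hq0) this
      · rintro (h | h) _ ⟨p, hp, q, hq, rfl⟩
        · rw [map_mul, h p hp, zero_mul]
        · rw [map_mul, h q hq, mul_zero])

/-- Closed sets of the Zariski topology are exactly the zero sets of polynomials. -/
theorem isClosed_iff {n : ℕ} (Z : Set (AlgStr n)) :
    IsClosed Z ↔ ∃ S : Set (MvPolynomial (Fin n × Fin n × Fin n) ℂ), zeros S = Z := by
  rw [← isOpen_compl_iff]
  change Zᶜᶜ ∈ Set.range zeros ↔ _
  rw [compl_compl]
  rfl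

/-- The ideal of all polynomials in the structure constants that vanish on `V`. -/
noncomputable def idealOf {n : ℕ} (V : Set (AlgStr n)) : Ideal (MvPolynomial (Fin n × Fin n × Fin n) ℂ) :=
  MvPolynomial.vanishingIdeal ℂ (K := ℂ) (σ := Fin n × Fin n × Fin n) V

/-- The dimension of an algebraic subset of the affine space of structure constants:
the Krull dimension of its coordinate ring. -/
noncomputable def varietyDim {n : ℕ} (V : Set (AlgStr n)) : WithBot ℕ∞ :=
  ringKrullDim (MvPolynomial (Fin n × Fin n × Fin n) ℂ ⧸ idealOf V)

/-- The product of two vectors in the algebra with structure constants `c`. -/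
noncomputable def mul {n : ℕ} (c : AlgStr n) (x y : Vec n) : Vec n :=
  fun k => ∑ i, ∑ j, c (i, j, k) * x i * y j

/-- The square `A²` of the algebra `A`: the linear span of all products. -/
noncomputable def square {n : ℕ} (c : AlgStr n) : Submodule ℂ (Vec n) :=
  Submodule.span ℂ {z | ∃ x y, z = mul c x y}

/-- The (two-sided) annihilator `{x | xA = Ax = 0}`. -/
noncomputable def ann {n : ℕ} (c : AlgStr n) : Submodule ℂ (Vec n) where
  carrier := {x | ∀ y, mul c x y = 0 ∧ mul c y x = 0}
  zero_mem' := fun y => by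
    constructor <;> · funext k; simp [mul]
  add_mem' := fun {a b} ha hb y => by
    have h1 : mul c (a + b) y = mul c a y + mul c b y := by
      funext k; simp [mul, mul_add, add_mul, Finset.sum_add_distrib]
    have h2 : mul c y (a + b) = mul c y a + mul c y b := by
      funext k; simp [mul, mul_add, Finset.sum_add_distrib]
    rw [h1, h2, (ha y).1, (hb y).1, (ha y).2, (hb y).2]
    simp
  smul_mem' := fun r a ha y => by
    have h1 : mul c (r • a) y = r • mul c a y := by
      funext k
      simp only [mul, Pi.smul_apply, smul_eq_mul, Finset.mul_sum]
      exact Finset.sum_congr rfl fun i _ => Finset.sum_congr rfl fun j _ => by ring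
    have h2 : mul c y (r • a) = r • mul c y a := by
      funext k
      simp only [mul, Pi.smul_apply, smul_eq_mul, Finset.mul_sum]
      exact Finset.sum_congr rfl fun i _ => Finset.sum_congr rfl fun j _ => by ring
    rw [h1, h2, (ha y).1, (ha y).2]
    simp

/-- The variety of `n`-dimensional 2-step nilpotent algebras: all products of three elements
vanish, that is, `(xy)z = 0` and `x(yz) = 0`. -/
def Nil2 (n : ℕ) : Set (AlgStr n) :=
  {c | ∀ x y z, mul c (mul c x y) z = 0 ∧ mul c x (mul c y z) = 0}

/-- The algebras `A` in `Nil2 n` with `dim A² ≤ k` and `dim Ann A ≥ k`. -/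
def Nil2k (n k : ℕ) : Set (AlgStr n) :=
  {c | c ∈ Nil2 n ∧ Module.finrank ℂ (square c) ≤ k ∧ k ≤ Module.finrank ℂ (ann c)}

/-- The orbit of an algebra structure under base change,
`(g * μ)(x, y) = g μ(g⁻¹ x, g⁻¹ y)` for `g` in the general linear group. -/
def orbit {n : ℕ} (c : AlgStr n) : Set (AlgStr n) :=
  {c' | ∃ g : Vec n ≃ₗ[ℂ] Vec n, ∀ x y, mul c' x y = g (mul c (g.symm x) (g.symm y))}

/-- The closure, in the Zariski topology, of the union of the orbits of a family. -/
def orbitClosure {n : ℕ} (F : Set (AlgStr n)) : Set (AlgStr n) :=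
  closure (⋃ c ∈ F, orbit c)

/-- The irreducible components of a subset of the affine space of structure constants,
with its subspace topology, as subsets of that affine space. -/
def components {n : ℕ} (V : Set (AlgStr n)) : Set (Set (AlgStr n)) :=
  (fun Z : Set V => Subtype.val '' Z) '' irreducibleComponents V

/-- The algebra with the multiplication table `e_i e_j = t i j`. -/
def ofTable {n : ℕ} (t : Fin n → Fin n → Vec n) : AlgStr n :=
  fun ijk => t ijk.1 ijk.2.1 ijk.2.2

/-- The standard basis of `ℂ⁵`; `e 0, …, e 4` are the vectors `e₁, …, e₅`. -/
def e (i : Fin 5) : Vec 5 := Pi.single i 1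

/-- `e₁e₁ = e₃ + λe₅`, `e₁e₂ = e₃`, `e₂e₁ = e₄`, `e₂e₂ = e₅`. -/
noncomputable def A133 (l : ℂ) : AlgStr 5 := ofTable
  ![![e 2 + l • e 4, e 2, 0, 0, 0],
    ![e 3, e 4, 0, 0, 0],
    0, 0, 0]

/-- For a pair of `3 × 3` matrices: `e_i e_j = a_ij e₄ + b_ij e₅` for `i, j ≤ 3`,
and all other products of basis vectors vanish. -/
noncomputable def ofPair (a b : Matrix (Fin 3) (Fin 3) ℂ) : AlgStr 5 := ofTable
  ![![a 0 0 • e 3 + b 0 0 • e 4, a 0 1 • e 3 + b 0 1 • e 4, a 0 2 • e 3 + b 0 2 • e 4, 0, 0],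
    ![a 1 0 • e 3 + b 1 0 • e 4, a 1 1 • e 3 + b 1 1 • e 4, a 1 2 • e 3 + b 1 2 • e 4, 0, 0],
    ![a 2 0 • e 3 + b 2 0 • e 4, a 2 1 • e 3 + b 2 1 • e 4, a 2 2 • e 3 + b 2 2 • e 4, 0, 0],
    0, 0]

/-- `e₁e₂ = e₅`, `e₂e₁ = λe₅`, `e₃e₄ = e₅`, `e₄e₃ = μe₅`. -/
noncomputable def H (l m : ℂ) : AlgStr 5 := ofTable
  ![![0, e 4, 0, 0, 0],
    ![l • e 4, 0, 0, 0, 0],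
    ![0, 0, 0, e 4, 0],
    ![0, 0, m • e 4, 0, 0],
    0]

/-- The one-parameter family `𝔙₂₊₃`. -/
def V23 : Set (AlgStr 5) := {c | ∃ l : ℂ, c = A133 l}

/-- The eight-parameter family `𝔙₃₊₂`. -/
def V32 : Set (AlgStr 5) :=
  {c | ∃ l m₁ m₂ m₃ m₄ m₅ m₆ m₇ : ℂ, c = ofPair
    !![1, 0, 0;
       0, 0, 1;
       0, l, 0]
    !![0, m₁, m₂;
       m₃, m₄, m₅;
       m₆, m₇, 1]}

/-- The two-parameter family `𝔙₄₊₁`. -/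
def V41 : Set (AlgStr 5) := {c | ∃ l m : ℂ, c = H l m}

end TwoStepNilpotent

open TwoStepNilpotent

namespace TwoStepNilpotent

open Filter Topology

/-! ### Polynomial functions and the Zariski topology -/

/-! Everything rests on the sets `Nil2k n k`, where dim A² ≤ k ≤ dim Ann A. Put n = m + k. In a
2-step nilpotent algebra A² ⊆ Ann A, so a k-dimensional subspace U fits between them. In a basis
whose last k vectors span U, the algebra is just a bilinear map w : ℂᵐ × ℂᵐ → ℂᵏ (`mem_nil2k_iff`).
Hence `Nil2k` is the union of the orbits of a linear space of structures `emb w`. It is closed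
because it is cut out by rank conditions (`isClosed_nil2k`). It is irreducible because the pairs (N,
w), with N a unipotent change of basis, parametrize a dense subset polynomially
(`isIrreducible_nil2k`).

For n = 5, an algebra with dim A² = s is generated modulo U by 5 - s vectors, so s ≤ (5 - s)² and s
≤ 3. The zero algebra lies in `Nil2k 5 1`, so k = 1, 2, 3 suffice (`nil2_eq_union`). Dimensions of
squares and annihilators exclude inclusions among these three sets, which are therefore the
components.

Each set is the orbit closure of its family because a generic w can be brought into the family by a
change of basis. For k = 1, 2 this is an inverse function argument for congruence of matrices at one
well-chosen point (`mem_nhds_of_congruence`); for k = 3 it is explicit (`emb_combination_mem`). A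
Euclidean neighbourhood suffices: a polynomial that vanishes near a point vanishes identically
(`mem_of_eventually_mem`).

The parametrizations have mk + m²k parameters, that is 18, 24 and 20 for k = 3, 2, 1. This bounds
the dimension above by 24, and for k = 2 all 24 parameters can be recovered generically from the
structure constants. -/

/-- A complex function on an affine space that is given by a polynomial. -/
def IsPolyFun {σ : Type*} (f : (σ → ℂ) → ℂ) : Prop :=
  ∃ p : MvPolynomial σ ℂ, ∀ x, MvPolynomial.eval x p = f x

namespace IsPolyFun

variable {σ τ ι : Type*} {f g : (σ → ℂ) → ℂ}

theorem const (a : ℂ) : IsPolyFun fun _ : σ → ℂ => a := ⟨MvPolynomial.C a, by simp⟩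

theorem coord (i : σ) : IsPolyFun fun x : σ → ℂ => x i := ⟨MvPolynomial.X i, by simp⟩

theorem add (hf : IsPolyFun f) (hg : IsPolyFun g) : IsPolyFun fun x => f x + g x := by
  obtain ⟨p, hp⟩ := hf
  obtain ⟨q, hq⟩ := hg
  exact ⟨p + q, fun x => by simp [hp, hq]⟩

theorem mul (hf : IsPolyFun f) (hg : IsPolyFun g) : IsPolyFun fun x => f x * g x := by
  obtain ⟨p, hp⟩ := hf
  obtain ⟨q, hq⟩ := hg
  exact ⟨p * q, fun x => by simp [hp, hq]⟩

theorem neg (hf : IsPolyFun f) : IsPolyFun fun x => -f x := by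
  obtain ⟨p, hp⟩ := hf
  exact ⟨-p, fun x => by simp [hp]⟩

theorem sum (s : Finset ι) {F : ι → (σ → ℂ) → ℂ} (h : ∀ i, IsPolyFun (F i)) :
    IsPolyFun fun x => ∑ i ∈ s, F i x := by
  choose p hp using h
  exact ⟨∑ i ∈ s, p i, fun x => by simp [hp]⟩

theorem prod (s : Finset ι) {F : ι → (σ → ℂ) → ℂ} (h : ∀ i, IsPolyFun (F i)) :
    IsPolyFun fun x => ∏ i ∈ s, F i x := by
  choose p hp using h
  exact ⟨∏ i ∈ s, p i, fun x => by simp [hp]⟩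

theorem det [Fintype ι] [DecidableEq ι] {M : (σ → ℂ) → Matrix ι ι ℂ}
    (h : ∀ i j, IsPolyFun fun x => M x i j) : IsPolyFun fun x => (M x).det := by
  simp only [Matrix.det_apply']
  exact .sum _ fun e => .mul (.const _) (.prod _ fun i => h _ _)

theorem comp {f : (τ → ℂ) → ℂ} (hf : IsPolyFun f) {F : (σ → ℂ) → τ → ℂ}
    (hF : ∀ t, IsPolyFun fun x => F x t) : IsPolyFun fun x => f (F x) := by
  obtain ⟨p, hp⟩ := hf
  choose q hq using hF
  refine ⟨MvPolynomial.aeval q p, fun x => ?_⟩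
  change _ = f (F x)
  rw [← hp, MvPolynomial.aeval_def, ← MvPolynomial.coe_eval₂Hom, ← RingHom.comp_apply,
    MvPolynomial.comp_eval₂Hom]
  have : (MvPolynomial.eval x).comp (algebraMap ℂ (MvPolynomial σ ℂ)) = RingHom.id ℂ := by
    ext a; simp
  rw [this, MvPolynomial.eval]
  congr 2
  funext t
  exact hq t x

end IsPolyFun

section Zariski

variable {n m : ℕ}

theorem isClosed_setOf_polyFun_eq_zero {f : AlgStr n → ℂ}
    (hf : IsPolyFun (σ := Fin n × Fin n × Fin n) f) : IsClosed {c : AlgStr n | f c = 0} := by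
  obtain ⟨p, hp⟩ := hf
  refine (isClosed_iff _).2 ⟨{p}, ?_⟩
  ext c
  simp only [zeros, Set.mem_singleton_iff, forall_eq, Set.mem_ofPred_eq]
  rw [← hp c]

theorem exists_separating_poly {Z : Set (AlgStr n)} (hZ : IsClosed Z) {c : AlgStr n}
    (hc : c ∉ Z) : ∃ p : MvPolynomial (Fin n × Fin n × Fin n) ℂ,
      (∀ z ∈ Z, MvPolynomial.eval (fun t => z t) p = 0) ∧
        MvPolynomial.eval (fun t => c t) p ≠ 0 := by
  obtain ⟨S, rfl⟩ := (isClosed_iff Z).1 hZ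
  simp only [zeros, Set.mem_ofPred_eq, not_forall] at hc
  obtain ⟨p, hp, hpc⟩ := hc
  exact ⟨p, fun z hz => hz p hp, hpc⟩

theorem continuous_of_isPolyFun {F : AlgStr n → AlgStr m}
    (hF : ∀ t, IsPolyFun (σ := Fin n × Fin n × Fin n) fun c => F c t) : Continuous F := by
  refine continuous_iff_isClosed.2 fun Z hZ => ?_
  obtain ⟨S, rfl⟩ := (isClosed_iff Z).1 hZ
  have : F ⁻¹' zeros S = ⋂ p ∈ S, {c | MvPolynomial.eval (fun t => F c t) p = 0} := by
    ext c; simp [zeros]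
  rw [this]
  refine isClosed_biInter fun p _ => isClosed_setOf_polyFun_eq_zero ?_
  exact IsPolyFun.comp (f := fun x => MvPolynomial.eval x p) ⟨p, fun _ => rfl⟩ hF

theorem differentiable_eval (p : MvPolynomial (Fin n × Fin n × Fin n) ℂ)
    {F : ℂ → AlgStr n} (hF : ∀ t, Differentiable ℂ fun s => F s t) :
    Differentiable ℂ fun s => MvPolynomial.eval (fun t => F s t) p := by
  induction p using MvPolynomial.induction_on with
  | C a => simp
  | add p q hp hq => simp only [map_add]; exact hp.fun_add hq
  | mul_X p i hp => simp only [map_mul, MvPolynomial.eval_X]; exact hp.fun_mul (hF i)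

/-- If a map into the space of structure constants is entire on lines and takes values in a
Zariski closed set near one point, then it takes values in this set everywhere. -/
theorem mem_of_eventually_mem {E : Type*} [AddCommGroup E] [Module ℂ E] [TopologicalSpace E]
    [ContinuousAdd E] [ContinuousSMul ℂ E] {Z : Set (AlgStr n)} (hZ : IsClosed Z)
    {F : E → AlgStr n} (hF : ∀ y v t, Differentiable ℂ fun s : ℂ => F (y + s • v) t)
    (y₀ : E) (h : ∀ᶠ y in 𝓝 y₀, F y ∈ Z) (y : E) : F y ∈ Z := by
  by_contra hy
  obtain ⟨p, hpZ, hp⟩ := exists_separating_poly hZ hy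
  -- The separating polynomial, restricted to the complex line from `y₀` to `y`, is entire in one
  -- variable, so the identity theorem applies.
  set φ : ℂ → ℂ := fun s => MvPolynomial.eval (fun t => F (y₀ + s • (y - y₀)) t) p
  have hφ : Differentiable ℂ φ := differentiable_eval p fun t => hF _ _ t
  have hcont : Tendsto (fun s : ℂ => y₀ + s • (y - y₀)) (𝓝 0) (𝓝 y₀) := by
    have : Continuous fun s : ℂ => y₀ + s • (y - y₀) := by fun_prop
    simpa using this.tendsto 0
  have hev : φ =ᶠ[𝓝 0] 0 := (hcont.eventually h).mono fun s hs => hpZ _ hs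
  have han : AnalyticOnNhd ℂ φ Set.univ := fun s _ => hφ.analyticAt s
  have := han.eqOn_zero_of_preconnected_of_eventuallyEq_zero isPreconnected_univ
    (Set.mem_univ 0) hev (Set.mem_univ 1)
  exact hp (by simpa [φ] using this)

end Zariski

/-! ### Change of basis -/

section Action

variable {n : ℕ}

/-- The structure `(x, y) ↦ G (c (H x, H y))`; for `H = G⁻¹` it is the change of basis. -/
def act (G H : Matrix (Fin n) (Fin n) ℂ) (c : AlgStr n) : AlgStr n :=
  fun t => ∑ a, ∑ b, ∑ d, c (a, b, d) * H a t.1 * H b t.2.1 * G t.2.2 d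

theorem mul_single (c : AlgStr n) (i j k : Fin n) :
    mul c (Pi.single i 1) (Pi.single j 1) k = c (i, j, k) := by
  simp only [mul, Pi.single_apply, mul_ite, mul_one, mul_zero, Finset.sum_ite_eq',
    Finset.mem_univ, if_true]

theorem algStr_ext {c c' : AlgStr n} (h : ∀ x y, mul c x y = mul c' x y) : c = c' := by
  funext t
  obtain ⟨i, j, k⟩ := t
  rw [← mul_single c, ← mul_single c', h]

theorem mul_act (G H : Matrix (Fin n) (Fin n) ℂ) (c : AlgStr n) (x y : Vec n) :
    mul (act G H c) x y = G.mulVec (mul c (H.mulVec x) (H.mulVec y)) := by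
  funext k
  have hl : mul (act G H c) x y k = ∑ p : Fin n × Fin n × Fin n × Fin n × Fin n,
      c (p.2.2.1, p.2.2.2.1, p.2.2.2.2) * H p.2.2.1 p.1 * H p.2.2.2.1 p.2.1 *
        G k p.2.2.2.2 * x p.1 * y p.2.1 := by
    simp only [mul, act, Finset.sum_mul, Fintype.sum_prod_type]
  have hr : G.mulVec (mul c (H.mulVec x) (H.mulVec y)) k =
      ∑ p : Fin n × Fin n × Fin n × Fin n × Fin n,
        c (p.2.1, p.2.2.1, p.1) * H p.2.1 p.2.2.2.1 * H p.2.2.1 p.2.2.2.2 *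
        G k p.1 * x p.2.2.2.1 * y p.2.2.2.2 := by
    simp only [mul, Matrix.mulVec, dotProduct, Fintype.sum_prod_type]
    refine Finset.sum_congr rfl fun d _ => ?_
    rw [Finset.mul_sum]
    refine Finset.sum_congr rfl fun a _ => ?_
    rw [Finset.mul_sum]
    refine Finset.sum_congr rfl fun b _ => ?_
    rw [mul_assoc (c _), Finset.sum_mul_sum, Finset.mul_sum, Finset.mul_sum]
    refine Finset.sum_congr rfl fun i _ => ?_
    rw [Finset.mul_sum, Finset.mul_sum]
    refine Finset.sum_congr rfl fun j _ => ?_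
    ring
  rw [hl, hr]
  -- Both sides are the same five-fold sum with its indices in a different order.
  refine Fintype.sum_equiv
    { toFun := fun p => (p.2.2.2.2, p.2.2.1, p.2.2.2.1, p.1, p.2.1)
      invFun := fun p => (p.2.2.2.1, p.2.2.2.2, p.2.1, p.2.2.1, p.1)
      left_inv := fun p => rfl
      right_inv := fun p => rfl } _ _ fun p => rfl

theorem act_one (c : AlgStr n) : act 1 1 c = c :=
  algStr_ext fun x y => by simp [mul_act]

theorem act_act (G H G' H' : Matrix (Fin n) (Fin n) ℂ) (c : AlgStr n) :
    act G H (act G' H' c) = act (G * G') (H' * H) c :=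
  algStr_ext fun x y => by simp [mul_act]

theorem mem_orbit_iff {c c' : AlgStr n} :
    c' ∈ orbit c ↔ ∃ G H : Matrix (Fin n) (Fin n) ℂ, G * H = 1 ∧ c' = act G H c := by
  constructor
  · rintro ⟨g, hg⟩
    refine ⟨LinearMap.toMatrix' g.toLinearMap, LinearMap.toMatrix' g.symm.toLinearMap, ?_,
      algStr_ext fun x y => ?_⟩
    · rw [← LinearMap.toMatrix'_comp, g.comp_symm, LinearMap.toMatrix'_id]
    · rw [mul_act, hg]
      simp only [LinearMap.toMatrix'_mulVec, LinearEquiv.coe_coe]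
  · rintro ⟨G, H, h, rfl⟩
    refine ⟨Matrix.toLin'OfInv (mul_eq_one_comm.1 h) h, fun x y => ?_⟩
    rw [mul_act]
    simp [Matrix.toLin'OfInv]

theorem act_mem_orbit {G H : Matrix (Fin n) (Fin n) ℂ} (h : G * H = 1) (c : AlgStr n) :
    act G H c ∈ orbit c := mem_orbit_iff.2 ⟨G, H, h, rfl⟩

theorem self_mem_orbit (c : AlgStr n) : c ∈ orbit c :=
  mem_orbit_iff.2 ⟨1, 1, one_mul 1, (act_one c).symm⟩

theorem isPolyFun_act (G H : Matrix (Fin n) (Fin n) ℂ) (t) :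
    IsPolyFun (σ := Fin n × Fin n × Fin n) fun c => act G H c t :=
  .sum _ fun _ => .sum _ fun _ => .sum _ fun _ =>
    .mul (.mul (.mul (.coord _) (.const _)) (.const _)) (.const _)

theorem continuous_act (G H : Matrix (Fin n) (Fin n) ℂ) : Continuous (act G H) :=
  continuous_of_isPolyFun fun t => isPolyFun_act G H t

/-- The closure of a union of orbits is stable under change of basis. -/
theorem act_mem_orbitClosure {F : Set (AlgStr n)} {G H : Matrix (Fin n) (Fin n) ℂ}
    (h : G * H = 1) {c : AlgStr n} (hc : c ∈ orbitClosure F) : act G H c ∈ orbitClosure F := by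
  refine map_mem_closure (continuous_act G H) hc ?_
  intro c' hc'
  simp only [Set.mem_iUnion, exists_prop] at hc' ⊢
  obtain ⟨c₀, hF, h₀⟩ := hc'
  obtain ⟨G', H', h', rfl⟩ := mem_orbit_iff.1 h₀
  refine ⟨c₀, hF, mem_orbit_iff.2 ⟨G * G', H' * H, ?_, act_act G H G' H' c₀⟩⟩
  rw [Matrix.mul_assoc, ← Matrix.mul_assoc G', h', Matrix.one_mul, h]

theorem subset_orbitClosure (F : Set (AlgStr n)) : F ⊆ orbitClosure F := fun c hc =>
  subset_closure (Set.mem_biUnion hc (self_mem_orbit c))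

theorem isClosed_orbitClosure (F : Set (AlgStr n)) : IsClosed (orbitClosure F) := isClosed_closure

end Action

/-! ### Two-step nilpotent structures in adapted coordinates -/

section Adapted

variable {n m k : ℕ}

/-- The structure on `ℂᵐ ⊕ ℂᵏ` given by a bilinear map `ℂᵐ × ℂᵐ → ℂᵏ`. -/
def emb (w : Fin m → Fin m → Fin k → ℂ) : AlgStr (m + k) := fun t =>
  Fin.addCases (fun i => Fin.addCases (fun j => Fin.addCases (fun _ => 0) (fun l => w i j l) t.2.2)
    (fun _ => 0) t.2.1) (fun _ => 0) t.1

variable (w : Fin m → Fin m → Fin k → ℂ)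

@[simp] theorem emb_apply (i j : Fin m) (l : Fin k) :
    emb w (Fin.castAdd k i, Fin.castAdd k j, Fin.natAdd m l) = w i j l := by simp [emb]

@[simp] theorem emb_natAdd_left (i : Fin k) (j l) : emb w (Fin.natAdd m i, j, l) = 0 := by
  simp [emb]

@[simp] theorem emb_natAdd_mid (i) (j : Fin k) (l) : emb w (i, Fin.natAdd m j, l) = 0 := by
  refine Fin.addCases (fun i => ?_) (fun i => ?_) i <;> simp [emb]

@[simp] theorem emb_castAdd_right (i j) (l : Fin m) : emb w (i, j, Fin.castAdd k l) = 0 := by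
  refine Fin.addCases (fun i => ?_) (fun i => ?_) i
  · refine Fin.addCases (fun j => ?_) (fun j => ?_) j <;> simp [emb]
  · simp [emb]

theorem eq_emb_iff {c : AlgStr (m + k)} : c = emb w ↔
    (∀ i j l, c (Fin.castAdd k i, Fin.castAdd k j, Fin.natAdd m l) = w i j l) ∧
    (∀ (i : Fin k) j l, c (Fin.natAdd m i, j, l) = 0) ∧
    (∀ i (j : Fin k) l, c (i, Fin.natAdd m j, l) = 0) ∧
    (∀ i j (l : Fin m), c (i, j, Fin.castAdd k l) = 0) := by
  constructor
  · rintro rfl; simp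
  · rintro ⟨h₁, h₂, h₃, h₄⟩
    funext ⟨i, j, l⟩
    refine Fin.addCases (fun i => ?_) (fun i => ?_) i
    · refine Fin.addCases (fun j => ?_) (fun j => ?_) j
      · refine Fin.addCases (fun l => ?_) (fun l => ?_) l <;> simp [h₁, h₄]
      · simp [h₃]
    · simp [h₂]

theorem act_emb (G H : Matrix (Fin (m + k)) (Fin (m + k)) ℂ) (i j l) :
    act G H (emb w) (i, j, l) = ∑ a : Fin m, ∑ b : Fin m, ∑ d : Fin k,
      w a b d * H (Fin.castAdd k a) i * H (Fin.castAdd k b) j * G l (Fin.natAdd m d) := by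
  simp [act, Fin.sum_univ_add]

theorem mul_emb (x y : Vec (m + k)) : mul (emb w) x y = Fin.append (0 : Fin m → ℂ)
    fun l => ∑ i, ∑ j, w i j l * x (Fin.castAdd k i) * y (Fin.castAdd k j) := by
  funext l
  refine Fin.addCases (fun l => ?_) (fun l => ?_) l <;> simp [mul, Fin.sum_univ_add]

/-- The inclusion of the last `k` coordinates. -/
def lastIncl (m k : ℕ) : (Fin k → ℂ) →ₗ[ℂ] Vec (m + k) where
  toFun x := Fin.append 0 x
  map_add' x y := by
    funext l
    refine Fin.addCases (fun l => ?_) (fun l => ?_) l <;> simp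
  map_smul' r x := by
    funext l
    refine Fin.addCases (fun l => ?_) (fun l => ?_) l <;> simp

theorem lastIncl_apply (x : Fin k → ℂ) : lastIncl m k x = Fin.append 0 x := rfl

theorem finrank_range_lastIncl : Module.finrank ℂ (LinearMap.range (lastIncl m k)) = k := by
  rw [LinearMap.finrank_range_of_inj, Module.finrank_fin_fun]
  intro x y h
  funext l
  simpa [lastIncl_apply] using congrFun h (Fin.natAdd m l)

theorem square_emb_le : square (emb w) ≤ LinearMap.range (lastIncl m k) := by
  refine Submodule.span_le.2 ?_
  rintro _ ⟨x, y, rfl⟩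
  rw [mul_emb]
  exact ⟨_, lastIncl_apply _⟩

theorem le_ann_emb : LinearMap.range (lastIncl m k) ≤ ann (emb w) := by
  rintro _ ⟨z, rfl⟩ y
  simp only [mul_emb, lastIncl_apply, Fin.append_left]
  constructor
  · funext l
    refine Fin.addCases (fun l => ?_) (fun l => ?_) l <;> simp
  · funext l
    refine Fin.addCases (fun l => ?_) (fun l => ?_) l <;> simp

/-- This turns the cubic identities into an inclusion of subspaces, between which a third one can be
inserted. -/
theorem mem_nil2_iff_square_le_ann {c : AlgStr n} : c ∈ Nil2 n ↔ square c ≤ ann c := by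
  constructor
  · intro h
    refine Submodule.span_le.2 ?_
    rintro _ ⟨x, y, rfl⟩ z
    exact ⟨(h x y z).1, (h z x y).2⟩
  · intro h x y z
    exact ⟨(h (Submodule.subset_span ⟨x, y, rfl⟩) z).1, (h (Submodule.subset_span ⟨y, z, rfl⟩) x).2⟩

theorem mem_nil2k_of_le {c : AlgStr n} (U : Submodule ℂ (Vec n)) (h₁ : square c ≤ U)
    (h₂ : U ≤ ann c) : c ∈ Nil2k n (Module.finrank ℂ U) :=
  ⟨mem_nil2_iff_square_le_ann.2 (h₁.trans h₂), Submodule.finrank_mono h₁, Submodule.finrank_mono h₂⟩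

theorem emb_mem_nil2k : emb w ∈ Nil2k (m + k) k := by
  have := mem_nil2k_of_le _ (square_emb_le w) (le_ann_emb w)
  rwa [finrank_range_lastIncl] at this

theorem square_of_equiv {c c' : AlgStr n} (g : Vec n ≃ₗ[ℂ] Vec n)
    (hg : ∀ x y, mul c' x y = g (mul c (g.symm x) (g.symm y))) :
    square c' = (square c).map g.toLinearMap := by
  rw [square, square, Submodule.map_span]
  congr 1
  ext z
  constructor
  · rintro ⟨x, y, rfl⟩
    exact ⟨_, ⟨_, _, rfl⟩, (hg x y).symm⟩
  · rintro ⟨_, ⟨x, y, rfl⟩, rfl⟩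
    exact ⟨g x, g y, by simp [hg]⟩

theorem ann_of_equiv {c c' : AlgStr n} (g : Vec n ≃ₗ[ℂ] Vec n)
    (hg : ∀ x y, mul c' x y = g (mul c (g.symm x) (g.symm y))) :
    ann c' = (ann c).map g.toLinearMap := by
  ext z
  constructor
  · intro hz
    refine ⟨g.symm z, fun y => ?_, by simp⟩
    have := hz (g y)
    simpa [hg] using this
  · rintro ⟨z, hz, rfl⟩ y
    have := hz (g.symm y)
    simp [hg, this.1, this.2]

theorem finrank_square_of_mem_orbit {c c' : AlgStr n} (h : c' ∈ orbit c) :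
    Module.finrank ℂ (square c') = Module.finrank ℂ (square c) := by
  obtain ⟨g, hg⟩ := h
  rw [square_of_equiv g hg]
  exact LinearEquiv.finrank_map_eq g _

theorem finrank_ann_of_mem_orbit {c c' : AlgStr n} (h : c' ∈ orbit c) :
    Module.finrank ℂ (ann c') = Module.finrank ℂ (ann c) := by
  obtain ⟨g, hg⟩ := h
  rw [ann_of_equiv g hg]
  exact LinearEquiv.finrank_map_eq g _

theorem mem_nil2_of_mem_orbit {c c' : AlgStr n} (hc : c ∈ Nil2 n) (h : c' ∈ orbit c) :
    c' ∈ Nil2 n := by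
  obtain ⟨g, hg⟩ := h
  rw [mem_nil2_iff_square_le_ann] at hc ⊢
  rw [square_of_equiv g hg, ann_of_equiv g hg]
  exact Submodule.map_mono hc

theorem mem_nil2k_of_mem_orbit {c c' : AlgStr n} (hc : c ∈ Nil2k n k) (h : c' ∈ orbit c) :
    c' ∈ Nil2k n k := by
  refine ⟨mem_nil2_of_mem_orbit hc.1 h, ?_⟩
  rw [finrank_square_of_mem_orbit h, finrank_ann_of_mem_orbit h]
  exact hc.2

theorem exists_submodule_between {V : Type*} [AddCommGroup V] [Module ℂ V]
    [FiniteDimensional ℂ V] {S T : Submodule ℂ V} (hST : S ≤ T) {r : ℕ}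
    (h₁ : Module.finrank ℂ S ≤ r) (h₂ : r ≤ Module.finrank ℂ T) :
    ∃ U, S ≤ U ∧ U ≤ T ∧ Module.finrank ℂ U = r := by
  induction r, h₁ using Nat.le_induction with
  | base => exact ⟨S, le_rfl, hST, rfl⟩
  | succ r _ ih =>
    obtain ⟨U, hSU, hUT, hU⟩ := ih (by omega)
    have hne : ¬ T ≤ U := fun h => by
      have := Submodule.finrank_mono h
      omega
    obtain ⟨v, hvT, hvU⟩ := SetLike.not_le_iff_exists.1 hne
    refine ⟨U ⊔ Submodule.span ℂ {v}, hSU.trans le_sup_left, sup_le hUT ?_, ?_⟩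
    · rwa [Submodule.span_singleton_le_iff_mem]
    · rw [Submodule.finrank_sup_span_singleton hvU, hU]

/-- The sets `dim A² ≤ k ≤ dim Ann A` consist of the orbits of structures in adapted
coordinates. -/
theorem mem_nil2k_iff {c : AlgStr (m + k)} :
    c ∈ Nil2k (m + k) k ↔ ∃ w : Fin m → Fin m → Fin k → ℂ, c ∈ orbit (emb w) := by
  constructor
  · rintro ⟨h₀, h₁, h₂⟩
    obtain ⟨U, hSU, hUT, hU⟩ := exists_submodule_between (mem_nil2_iff_square_le_ann.1 h₀) h₁ h₂
    obtain ⟨U', hc⟩ := U.exists_isCompl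
    have hU' : Module.finrank ℂ U' = m := by
      have := Submodule.finrank_add_eq_of_isCompl hc
      rw [Module.finrank_fin_fun] at this
      omega
    let b : Module.Basis (Fin (m + k)) ℂ (Vec (m + k)) :=
      -- A basis of the complement `U'` comes first and a basis of `U` last, to match the order of
      -- coordinates in `emb`.
      ((((Module.finBasisOfFinrankEq ℂ U' hU').prod (Module.finBasisOfFinrankEq ℂ U hU)).map
        (Submodule.prodEquivOfIsCompl U' U hc.symm)).reindex finSumFinEquiv)
    let g : Vec (m + k) ≃ₗ[ℂ] Vec (m + k) := b.equivFun.symm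
    have hgb : ∀ j, g (Pi.single j 1) = b j := fun j => by
      have : Pi.single j 1 = b.equivFun (b j) := by
        funext i
        rw [b.equivFun_self, Pi.single_apply]
        simp only [eq_comm]
      rw [this]
      exact b.equivFun.symm_apply_apply _
    have hgU : ∀ i : Fin k, g (Pi.single (Fin.natAdd m i) 1) ∈ U := fun i => by
      rw [hgb]; simp [b]
    have hgl : ∀ z ∈ U, ∀ l : Fin m, g.symm z (Fin.castAdd k l) = 0 := fun z hz l => by
      have : (Submodule.prodEquivOfIsCompl U' U hc.symm).symm z = (0, ⟨z, hz⟩) := by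
        rw [LinearEquiv.symm_apply_eq]; simp
      simp [g, b, this]
    let c' : AlgStr (m + k) := fun t =>
      g.symm (mul c (g (Pi.single t.1 1)) (g (Pi.single t.2.1 1))) t.2.2
    -- `U ≤ ann c` kills the products with one of the last k basis vectors, and `square c ≤ U` kills
    -- the first m coordinates of every product.
    have hc' : c' = emb fun i j l =>
        c' (Fin.castAdd k i, Fin.castAdd k j, Fin.natAdd m l) := by
      refine (eq_emb_iff _).2 ⟨fun _ _ _ => rfl, fun i j l => ?_, fun i j l => ?_, fun i j l => ?_⟩
      · simp [c', (hUT (hgU i) _).1]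
      · simp [c', (hUT (hgU j) _).2]
      · exact hgl _ (hSU (Submodule.subset_span ⟨_, _, rfl⟩)) l
    have hcc' : c' = act (LinearMap.toMatrix' g.symm.toLinearMap)
        (LinearMap.toMatrix' g.toLinearMap) c := by
      funext t
      obtain ⟨i, j, l⟩ := t
      rw [← mul_single (act _ _ c), mul_act]
      simp only [LinearMap.toMatrix'_mulVec, LinearEquiv.coe_coe]
      rfl
    have key : c ∈ orbit c' := by
      refine ⟨g, fun x y => ?_⟩
      rw [hcc', mul_act]
      simp only [LinearMap.toMatrix'_mulVec, LinearEquiv.coe_coe, LinearEquiv.apply_symm_apply]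
    exact ⟨_, (congrArg (c ∈ orbit ·) hc').mp key⟩
  · rintro ⟨w, hw⟩
    exact mem_nil2k_of_mem_orbit (emb_mem_nil2k w) hw

end Adapted

/-! ### Rank conditions are closed -/

section Rank

/-- If the rank exceeds `r`, some `B` makes the columns of `M * B` independent, and a left inverse
`A` gives `A * M * B = 1`. Letting `A` and `B` range over all matrices replaces the bookkeeping of
minors. -/
theorem rank_le_iff_det_eq_zero {ι κ : Type*} [Fintype ι] [Fintype κ] [DecidableEq ι]
    [DecidableEq κ] (M : Matrix ι κ ℂ) (r : ℕ) : M.rank ≤ r ↔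
      ∀ (A : Matrix (Fin (r + 1)) ι ℂ) (B : Matrix κ (Fin (r + 1)) ℂ), (A * M * B).det = 0 := by
  constructor
  · intro h A B
    by_contra hdet
    have h₁ := Matrix.rank_of_isUnit (A * M * B) ((Matrix.isUnit_iff_isUnit_det _).2 (Ne.isUnit hdet))
    have h₂ := (Matrix.rank_mul_le_left (A * M) B).trans (Matrix.rank_mul_le_right A M)
    rw [Fintype.card_fin] at h₁
    omega
  · intro h
    by_contra hr
    have hr : r + 1 ≤ Module.finrank ℂ (LinearMap.range M.mulVecLin) := by
      rw [← Matrix.rank]; omega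
    obtain ⟨v, hv⟩ := exists_linearIndependent_of_le_finrank hr
    choose x hx using fun j => (v j).2
    have hv' : LinearIndependent ℂ fun j => (v j : ι → ℂ) := by
      exact hv.map' (Submodule.subtype _) (Submodule.ker_subtype _)
    set B : Matrix κ (Fin (r + 1)) ℂ := fun q j => x j q
    have hcol : (M * B).col = fun j => (v j : ι → ℂ) := by
      funext j i
      rw [← hx j]
      rfl
    have hinj : LinearMap.ker (M * B).mulVecLin = ⊥ := by
      rw [LinearMap.ker_eq_bot, Matrix.coe_mulVecLin, Matrix.mulVec_injective_iff, hcol]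
      exact hv'
    obtain ⟨f, hf⟩ := LinearMap.exists_leftInverse_of_injective _ hinj
    have hA : LinearMap.toMatrix' f * (M * B) = 1 := by
      rw [← LinearMap.toMatrix'_id, ← hf, LinearMap.toMatrix'_comp]
      congr 1
      exact (LinearMap.toMatrix'_toLin' _).symm
    have := h (LinearMap.toMatrix' f) B
    rw [Matrix.mul_assoc, hA, Matrix.det_one] at this
    exact one_ne_zero this

variable {n : ℕ}

theorem isClosed_rank_le {ι κ : Type*} [Fintype ι] [Fintype κ] [DecidableEq ι] [DecidableEq κ]
    {M : AlgStr n → Matrix ι κ ℂ}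
    (hM : ∀ i j, IsPolyFun (σ := Fin n × Fin n × Fin n) fun c => M c i j) (r : ℕ) :
    IsClosed {c | (M c).rank ≤ r} := by
  simp only [rank_le_iff_det_eq_zero, Set.ofPred_forall]
  refine isClosed_iInter fun A => isClosed_iInter fun B => isClosed_setOf_polyFun_eq_zero ?_
  refine IsPolyFun.det fun i j => ?_
  simp only [Matrix.mul_apply]
  exact .sum _ fun _ => .mul (.sum _ fun _ => .mul (.const _) (hM _ _)) (.const _)

theorem isPolyFun_mul {x y : AlgStr n → Vec n}
    (hx : ∀ i, IsPolyFun (σ := Fin n × Fin n × Fin n) fun c => x c i)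
    (hy : ∀ i, IsPolyFun (σ := Fin n × Fin n × Fin n) fun c => y c i) (k : Fin n) :
    IsPolyFun (σ := Fin n × Fin n × Fin n) fun c => mul c (x c) (y c) k :=
  .sum _ fun _ => .sum _ fun _ => .mul (.mul (.coord _) (hx _)) (hy _)

theorem isClosed_nil2 : IsClosed (Nil2 n) := by
  have : Nil2 n = ⋂ x, ⋂ y, ⋂ z, ⋂ k,
      ({c | mul c (mul c x y) z k = 0} ∩ {c | mul c x (mul c y z) k = 0}) := by
    ext c
    simp only [Nil2, Set.mem_ofPred_eq, Set.mem_iInter, Set.mem_inter_iff, funext_iff,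
      Pi.zero_apply, ← forall_and]
  rw [this]
  refine isClosed_iInter fun x => isClosed_iInter fun y => isClosed_iInter fun z =>
    isClosed_iInter fun k => IsClosed.inter ?_ ?_
  · exact isClosed_setOf_polyFun_eq_zero (isPolyFun_mul (x := fun c => mul c x y) (y := fun _ => z)
      (isPolyFun_mul (x := fun _ => x) (y := fun _ => y) (fun _ => .const _) fun _ => .const _)
      (fun _ => .const _) k)
  · exact isClosed_setOf_polyFun_eq_zero (isPolyFun_mul (x := fun _ => x) (y := fun c => mul c y z)
      (fun _ => .const _)
      (isPolyFun_mul (x := fun _ => y) (y := fun _ => z) (fun _ => .const _) fun _ => .const _) k)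

/-- The matrix whose columns are the products of basis vectors. -/
def squareMatrix (c : AlgStr n) : Matrix (Fin n) (Fin n × Fin n) ℂ :=
  Matrix.of fun l p => c (p.1, p.2, l)

/-- The matrix of the linear map that sends `x` to the operators of multiplication by `x`. -/
def annMatrix (c : AlgStr n) : Matrix ((Fin n × Fin n) ⊕ (Fin n × Fin n)) (Fin n) ℂ :=
  Matrix.of fun p i => p.elim (fun p => c (i, p.1, p.2)) fun p => c (p.1, i, p.2)

theorem square_eq_range (c : AlgStr n) : square c = LinearMap.range (squareMatrix c).mulVecLin := by
  refine le_antisymm (Submodule.span_le.2 ?_) ?_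
  · rintro _ ⟨x, y, rfl⟩
    refine ⟨fun p => x p.1 * y p.2, ?_⟩
    funext l
    simp [squareMatrix, Matrix.mulVec, dotProduct, mul, Fintype.sum_prod_type, mul_assoc]
  · rw [Matrix.range_mulVecLin]
    refine Submodule.span_mono ?_
    rintro _ ⟨⟨i, j⟩, rfl⟩
    refine ⟨Pi.single i 1, Pi.single j 1, ?_⟩
    funext l
    rw [mul_single]
    rfl

theorem ann_eq_ker (c : AlgStr n) : ann c = LinearMap.ker (annMatrix c).mulVecLin := by
  ext x
  rw [LinearMap.mem_ker]
  have h₁ : ∀ j l, mul c x (Pi.single j 1) l = ∑ i, c (i, j, l) * x i := fun j l => by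
    simp [mul, Pi.single_apply]
  have h₂ : ∀ j l, mul c (Pi.single j 1) x l = ∑ i, c (j, i, l) * x i := fun j l => by
    simp only [mul, Pi.single_apply, mul_ite, mul_one, mul_zero, ite_mul, zero_mul]
    rw [Finset.sum_comm]
    simp
  constructor
  · intro hx
    funext p
    rcases p with ⟨j, l⟩ | ⟨j, l⟩
    · exact (h₁ j l).symm.trans (congrFun (hx (Pi.single j 1)).1 l)
    · exact (h₂ j l).symm.trans (congrFun (hx (Pi.single j 1)).2 l)
  · intro hx y
    constructor
    · funext l
      have : ∀ j, ∑ i, c (i, j, l) * x i = 0 := fun j => congrFun hx (.inl (j, l))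
      simp only [mul, Pi.zero_apply]
      rw [Finset.sum_comm]
      simp [← Finset.sum_mul, this]
    · funext l
      have : ∀ j, ∑ i, c (j, i, l) * x i = 0 := fun j => congrFun hx (.inr (j, l))
      simp only [mul, Pi.zero_apply]
      refine Finset.sum_eq_zero fun i _ => ?_
      rw [← mul_zero (y i), ← this i, Finset.mul_sum]
      exact Finset.sum_congr rfl fun j _ => by ring

theorem finrank_square (c : AlgStr n) :
    Module.finrank ℂ (square c) = (squareMatrix c).rank := by rw [square_eq_range]; rfl

theorem finrank_ann_add_rank (c : AlgStr n) :
    (annMatrix c).rank + Module.finrank ℂ (ann c) = n := by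
  have := LinearMap.finrank_range_add_finrank_ker (annMatrix c).mulVecLin
  rwa [← ann_eq_ker, Module.finrank_fin_fun] at this

theorem isClosed_nil2k (k : ℕ) : IsClosed (Nil2k n k) := by
  -- By rank-nullity a lower bound for the annihilator is an upper bound for a rank. The clause `k ≤
  -- n` guards against the truncated subtraction `n - k`.
  have : Nil2k n k = Nil2 n ∩
      ({c | (squareMatrix c).rank ≤ k} ∩ {c | k ≤ n ∧ (annMatrix c).rank ≤ n - k}) := by
    ext c
    have := finrank_ann_add_rank c
    simp only [Nil2k, Set.mem_ofPred_eq, Set.mem_inter_iff, finrank_square]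
    refine and_congr_right fun _ => and_congr_right fun _ => ?_
    omega
  rw [this]
  refine isClosed_nil2.inter (IsClosed.inter (isClosed_rank_le (fun i j => .coord _) k) ?_)
  by_cases hk : k ≤ n
  · simp only [hk, true_and]
    refine isClosed_rank_le (fun i j => ?_) _
    rcases i with i | i <;> exact .coord _
  · simp [hk]

end Rank

/-! ### Polynomial parametrizations -/

section Parametrization

variable {n : ℕ} {σ : Type*}

theorem IsPolyFun.differentiable {f : (σ → ℂ) → ℂ} (hf : IsPolyFun f) (y v : σ → ℂ) :
    Differentiable ℂ fun s : ℂ => f (y + s • v) := by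
  obtain ⟨p, hp⟩ := hf
  simp only [← hp]
  clear hp
  induction p using MvPolynomial.induction_on with
  | C a => simp
  | add p q hp hq =>
    simp only [map_add]
    exact hp.fun_add hq
  | mul_X p i hp =>
    simp only [map_mul, MvPolynomial.eval_X, Pi.add_apply, Pi.smul_apply]
    exact hp.fun_mul (by fun_prop)

theorem mem_of_eventually_mem_of_isPolyFun {Z : Set (AlgStr n)} (hZ : IsClosed Z)
    {F : (σ → ℂ) → AlgStr n} (hF : ∀ t, IsPolyFun fun y => F y t) (y₀ : σ → ℂ)
    (h : ∀ᶠ y in 𝓝 y₀, F y ∈ Z) (y : σ → ℂ) : F y ∈ Z :=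
  mem_of_eventually_mem hZ (fun y v t => (hF t).differentiable y v) y₀ h y

/-- The image of an affine space under a polynomial map is irreducible. -/
theorem forall_mem_or_forall_mem {F : (σ → ℂ) → AlgStr n}
    (hF : ∀ t, IsPolyFun fun y => F y t) {Z₁ Z₂ : Set (AlgStr n)} (h₁ : IsClosed Z₁)
    (h₂ : IsClosed Z₂) (h : ∀ y, F y ∈ Z₁ ∪ Z₂) : (∀ y, F y ∈ Z₁) ∨ ∀ y, F y ∈ Z₂ := by
  by_contra! hc
  obtain ⟨⟨y₁, hy₁⟩, ⟨y₂, hy₂⟩⟩ := hc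
  obtain ⟨p, hpZ, hp⟩ := exists_separating_poly h₁ hy₁
  have hd : Differentiable ℂ fun s : ℂ =>
      MvPolynomial.eval (fun t => F (y₁ + s • (y₂ - y₁)) t) p :=
    differentiable_eval p fun t => (hF t).differentiable _ _
  -- On the line from `y₁` to `y₂`, points close to `y₁` avoid `Z₁` and so lie in `Z₂`. This then
  -- propagates along the line to `y₂`.
  have hne : ∀ᶠ s : ℂ in 𝓝 0, MvPolynomial.eval (fun t => F (y₁ + s • (y₂ - y₁)) t) p ≠ 0 := by
    refine hd.continuous.continuousAt.eventually_ne ?_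
    simpa using hp
  have hev : ∀ᶠ s : ℂ in 𝓝 0, F (y₁ + s • (y₂ - y₁)) ∈ Z₂ :=
    hne.mono fun s hs => (h _).resolve_left fun hZ => hs (hpZ _ hZ)
  have := mem_of_eventually_mem h₂ (F := fun s : ℂ => F (y₁ + s • (y₂ - y₁)))
    (fun y v t => by
      have := (hF t).differentiable (y₁ + y • (y₂ - y₁)) (v • (y₂ - y₁))
      simpa [add_smul, mul_smul, add_assoc] using this) 0 hev 1
  exact hy₂ (by simpa using this)

end Parametrization

/-! ### Block matrices and the dense parametrization of `Nil2k` -/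

section Blocks

variable {m k : ℕ}

/-- A square matrix of size `m + k`, given by its four blocks. -/
def blk (A : Matrix (Fin m) (Fin m) ℂ) (B : Matrix (Fin m) (Fin k) ℂ)
    (C : Matrix (Fin k) (Fin m) ℂ) (D : Matrix (Fin k) (Fin k) ℂ) :
    Matrix (Fin (m + k)) (Fin (m + k)) ℂ :=
  Matrix.reindexAlgEquiv ℂ ℂ finSumFinEquiv (Matrix.fromBlocks A B C D)

variable (A : Matrix (Fin m) (Fin m) ℂ) (B : Matrix (Fin m) (Fin k) ℂ)
    (C : Matrix (Fin k) (Fin m) ℂ) (D : Matrix (Fin k) (Fin k) ℂ)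

@[simp] theorem blk_apply₁₁ (i j) : blk A B C D (Fin.castAdd k i) (Fin.castAdd k j) = A i j := by
  simp [blk]

@[simp] theorem blk_apply₁₂ (i j) : blk A B C D (Fin.castAdd k i) (Fin.natAdd m j) = B i j := by
  simp [blk]

@[simp] theorem blk_apply₂₁ (i j) : blk A B C D (Fin.natAdd m i) (Fin.castAdd k j) = C i j := by
  simp [blk]

@[simp] theorem blk_apply₂₂ (i j) : blk A B C D (Fin.natAdd m i) (Fin.natAdd m j) = D i j := by
  simp [blk]

theorem blk_mul (A' : Matrix (Fin m) (Fin m) ℂ) (B' : Matrix (Fin m) (Fin k) ℂ)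
    (C' : Matrix (Fin k) (Fin m) ℂ) (D' : Matrix (Fin k) (Fin k) ℂ) :
    blk A B C D * blk A' B' C' D' =
      blk (A * A' + B * C') (A * B' + B * D') (C * A' + D * C') (C * B' + D * D') := by
  rw [blk, blk, ← map_mul, Matrix.fromBlocks_multiply, blk]

theorem blk_one : blk (1 : Matrix (Fin m) (Fin m) ℂ) 0 0 (1 : Matrix (Fin k) (Fin k) ℂ) = 1 := by
  rw [blk, Matrix.fromBlocks_one, map_one]

theorem blk_injective {A A' : Matrix (Fin m) (Fin m) ℂ} {B B' : Matrix (Fin m) (Fin k) ℂ}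
    {C C' : Matrix (Fin k) (Fin m) ℂ} {D D' : Matrix (Fin k) (Fin k) ℂ}
    (h : blk A B C D = blk A' B' C' D') : A = A' ∧ B = B' ∧ C = C' ∧ D = D' :=
  Matrix.fromBlocks_inj.1 ((Matrix.reindexAlgEquiv ℂ ℂ finSumFinEquiv).injective h)

theorem exists_blk (M : Matrix (Fin (m + k)) (Fin (m + k)) ℂ) :
    ∃ A B C D, M = blk (m := m) (k := k) A B C D :=
  ⟨_, _, _, _, by rw [blk, Matrix.fromBlocks_toBlocks, AlgEquiv.apply_symm_apply]⟩

variable (w : Fin m → Fin m → Fin k → ℂ)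

/-- Block triangular matrices preserve the structures in adapted coordinates. -/
theorem act_lower_emb {S : Matrix (Fin m) (Fin m) ℂ} {Q : Matrix (Fin (m + k)) (Fin (m + k)) ℂ}
    (h : blk S 0 C D * Q = 1) : ∃ w', act (blk S 0 C D) Q (emb w) = emb w' := by
  obtain ⟨A', B', C', D', rfl⟩ := exists_blk Q
  rw [blk_mul, ← blk_one] at h
  obtain ⟨h₁, h₂, -, -⟩ := blk_injective h
  simp only [Matrix.zero_mul, add_zero] at h₁ h₂
  -- The inverse is again block lower triangular, so the span of the last k basis vectors is
  -- preserved in both directions.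
  have hB : B' = 0 := by
    rw [← Matrix.one_mul B', ← mul_eq_one_comm.1 h₁, Matrix.mul_assoc, h₂, Matrix.mul_zero]
  subst hB
  refine ⟨_, (eq_emb_iff _).2 ⟨fun _ _ _ => rfl, fun i j l => ?_, fun i j l => ?_,
    fun i j l => ?_⟩⟩
  all_goals simp [act_emb]

/-- The polynomial parametrization of a dense subset of the set `dim A² ≤ k ≤ dim Ann A`. -/
def unipotentAct (N : Matrix (Fin m) (Fin k) ℂ) (w : Fin m → Fin m → Fin k → ℂ) : AlgStr (m + k) :=
  act (blk 1 N 0 1) (blk 1 (-N) 0 1) (emb w)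

theorem blk_unipotent_mul (N : Matrix (Fin m) (Fin k) ℂ) :
    blk 1 N 0 1 * blk 1 (-N) 0 1 = 1 := by
  rw [blk_mul, ← blk_one]; simp

theorem unipotentAct_mem_orbit (N : Matrix (Fin m) (Fin k) ℂ) :
    unipotentAct N w ∈ orbit (emb w) :=
  act_mem_orbit (blk_unipotent_mul N) _

/-- Block elimination with the invertible corner `D` factors the matrix as upper unipotent times
lower triangular. The lower triangular factor only changes `w`. -/
theorem act_mem_of_isUnit_block {Z : Set (AlgStr (m + k))} (hZ : ∀ N w, unipotentAct N w ∈ Z)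
    (hD : IsUnit D.det) {Q : Matrix (Fin (m + k)) (Fin (m + k)) ℂ} (h : blk A B C D * Q = 1) :
    act (blk A B C D) Q (emb w) ∈ Z := by
  have hfac : blk A B C D = blk 1 (B * D⁻¹) 0 1 * blk (A - B * D⁻¹ * C) 0 C D := by
    rw [blk_mul]
    simp [Matrix.mul_assoc, Matrix.nonsing_inv_mul _ hD]
  have hinv : blk (A - B * D⁻¹ * C) 0 C D * (Q * blk 1 (B * D⁻¹) 0 1) = 1 := by
    rw [← Matrix.mul_assoc]
    refine mul_eq_one_comm.1 ?_
    rw [← Matrix.mul_assoc, ← hfac, h]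
  obtain ⟨w', hw'⟩ := act_lower_emb C D w hinv
  have : act (blk A B C D) Q (emb w) = unipotentAct (B * D⁻¹) w' := by
    rw [unipotentAct, ← hw', act_act, ← hfac, Matrix.mul_assoc, blk_unipotent_mul, Matrix.mul_one]
  rw [this]
  exact hZ _ _

/-- The inverse matrix enters quadratically, so a scalar factor of it can be absorbed into `w`. This
permits replacing the inverse by the adjugate, which is polynomial in the matrix. -/
theorem act_smul_right_emb (G H : Matrix (Fin (m + k)) (Fin (m + k)) ℂ) (r : ℂ) :
    act G (r • H) (emb w) = act G H (emb fun i j l => r ^ 2 * w i j l) := by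
  funext ⟨i, j, l⟩
  simp only [act_emb, Matrix.smul_apply, smul_eq_mul]
  exact Finset.sum_congr rfl fun a _ => Finset.sum_congr rfl fun b _ =>
    Finset.sum_congr rfl fun d _ => by ring

theorem isPolyFun_adjugate {σ : Type*} {n : ℕ} {M : (σ → ℂ) → Matrix (Fin n) (Fin n) ℂ}
    (h : ∀ i j, IsPolyFun fun x => M x i j) (i j) : IsPolyFun fun x => (M x).adjugate i j := by
  simp only [Matrix.adjugate_apply]
  refine IsPolyFun.det fun a b => ?_
  by_cases ha : a = j
  · subst ha
    simp only [Matrix.updateRow_self]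
    exact .const _
  · simp only [Matrix.updateRow_ne ha]
    exact h a b

theorem isPolyFun_act_emb {σ : Type*} {G H : (σ → ℂ) → Matrix (Fin (m + k)) (Fin (m + k)) ℂ}
    {w : (σ → ℂ) → Fin m → Fin m → Fin k → ℂ} (hG : ∀ i j, IsPolyFun fun x => G x i j)
    (hH : ∀ i j, IsPolyFun fun x => H x i j) (hw : ∀ i j l, IsPolyFun fun x => w x i j l) (t) :
    IsPolyFun fun x => act (G x) (H x) (emb (w x)) t := by
  obtain ⟨i, j, l⟩ := t
  simp only [act_emb]
  exact .sum _ fun _ => .sum _ fun _ => .sum _ fun _ =>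
    .mul (.mul (.mul (hw _ _ _) (hH _ _)) (hH _ _)) (hG _ _)

/-- The parametrized structures are Zariski dense in the set `dim A² ≤ k ≤ dim Ann A`. -/
theorem nil2k_subset_of_unipotentAct_mem {Z : Set (AlgStr (m + k))} (hcl : IsClosed Z)
    (hZ : ∀ N w, unipotentAct N w ∈ Z) : Nil2k (m + k) k ⊆ Z := by
  -- With the adjugate the map is defined and polynomial for all `h`, singular ones included, so it
  -- is enough to treat matrices near the identity, where `h` and its lower right block are
  -- invertible.
  have key : ∀ (w : Fin m → Fin m → Fin k → ℂ) (h : Matrix (Fin (m + k)) (Fin (m + k)) ℂ),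
      act h h.adjugate (emb w) ∈ Z := by
    intro w h
    let M : (Fin (m + k) × Fin (m + k) → ℂ) → Matrix (Fin (m + k)) (Fin (m + k)) ℂ :=
      fun x => Matrix.of fun i j => x (i, j)
    have hM : Continuous M := by
      refine continuous_matrix fun i j => ?_
      exact continuous_apply (i, j)
    have hMp : ∀ i j, IsPolyFun fun x => M x i j := fun i j => .coord (i, j)
    have hone : M (fun p => (1 : Matrix (Fin (m + k)) (Fin (m + k)) ℂ) p.1 p.2) = 1 := rfl
    have := mem_of_eventually_mem_of_isPolyFun hcl (F := fun x => act (M x) (M x).adjugate (emb w))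
      (isPolyFun_act_emb hMp (isPolyFun_adjugate hMp) fun _ _ _ => .const _)
      (fun p => (1 : Matrix (Fin (m + k)) (Fin (m + k)) ℂ) p.1 p.2) ?_ fun p => h p.1 p.2
    · exact this
    have h₁ : ∀ᶠ x in 𝓝 (fun p : Fin (m + k) × Fin (m + k) =>
        (1 : Matrix (Fin (m + k)) (Fin (m + k)) ℂ) p.1 p.2), (M x).det ≠ 0 := by
      refine hM.matrix_det.continuousAt.eventually_ne ?_
      rw [hone, Matrix.det_one]
      exact one_ne_zero
    have h₂ : ∀ᶠ x in 𝓝 (fun p : Fin (m + k) × Fin (m + k) =>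
        (1 : Matrix (Fin (m + k)) (Fin (m + k)) ℂ) p.1 p.2),
        ((M x).submatrix (Fin.natAdd m) (Fin.natAdd m)).det ≠ 0 := by
      refine (hM.matrix_submatrix _ _).matrix_det.continuousAt.eventually_ne ?_
      rw [hone, Matrix.submatrix_one _ (Fin.natAdd_injective k m), Matrix.det_one]
      exact one_ne_zero
    filter_upwards [h₁, h₂] with x hx₁ hx₂
    have hadj : (M x).adjugate = (M x).det • (M x)⁻¹ := by
      rw [Matrix.inv_def, smul_smul, Ring.mul_inverse_cancel _ (Ne.isUnit hx₁), one_smul]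
    have hinv := Matrix.mul_nonsing_inv (M x) (Ne.isUnit hx₁)
    rw [hadj, act_smul_right_emb]
    generalize M x = L at hx₂ hinv
    obtain ⟨A, B, C, D, rfl⟩ := exists_blk (m := m) (k := k) L
    refine act_mem_of_isUnit_block A B C D _ hZ (Ne.isUnit ?_) hinv
    convert hx₂
    ext i j
    simp
  intro c hc
  obtain ⟨w, hw⟩ := mem_nil2k_iff.1 hc
  obtain ⟨G, H, hGH, rfl⟩ := mem_orbit_iff.1 hw
  have hdet : IsUnit G.det := Matrix.isUnit_det_of_right_inverse hGH
  have hH : H = Ring.inverse G.det • G.adjugate := by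
    rw [← Matrix.inv_def, Matrix.inv_eq_right_inv hGH]
  rw [hH, act_smul_right_emb]
  exact key _ _

/-- The parameters of `unipotentAct`, as the coordinates of one affine space. -/
abbrev Param (m k : ℕ) : Type := (Fin m × Fin k) ⊕ (Fin m × Fin m × Fin k)

/-- The polynomial parametrization `unipotentAct`, on one affine space. -/
def paramMap (y : Param m k → ℂ) : AlgStr (m + k) :=
  unipotentAct (Matrix.of fun i j => y (.inl (i, j))) fun i j l => y (.inr (i, j, l))

theorem paramMap_mem (y : Param m k → ℂ) : paramMap y ∈ Nil2k (m + k) k :=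
  mem_nil2k_iff.2 ⟨_, unipotentAct_mem_orbit _ _⟩

theorem isPolyFun_paramMap (t) : IsPolyFun fun y : Param m k → ℂ => paramMap y t := by
  refine isPolyFun_act_emb (fun i j => ?_) (fun i j => ?_) (fun i j l => .coord _) t
  · refine Fin.addCases (fun i => ?_) (fun i => ?_) i <;>
      refine Fin.addCases (fun j => ?_) (fun j => ?_) j <;> simp
    exacts [.const _, .coord _, .const _, .const _]
  · refine Fin.addCases (fun i => ?_) (fun i => ?_) i <;>
      refine Fin.addCases (fun j => ?_) (fun j => ?_) j <;> simp
    exacts [.const _, .neg (.coord _), .const _, .const _]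

theorem nil2k_subset_of_paramMap_mem {Z : Set (AlgStr (m + k))} (hcl : IsClosed Z)
    (hZ : ∀ y : Param m k → ℂ, paramMap y ∈ Z) : Nil2k (m + k) k ⊆ Z :=
  nil2k_subset_of_unipotentAct_mem hcl fun N w =>
    hZ (Sum.elim (fun p => N p.1 p.2) fun p => w p.1 p.2.1 p.2.2)

/-- Irreducibility passes from the parameter space to its image, and a closed set containing the
image contains all of `Nil2k`. -/
theorem isIrreducible_nil2k : IsIrreducible (Nil2k (m + k) k) := by
  refine ⟨⟨_, paramMap_mem 0⟩, isPreirreducible_iff_isClosed_union_isClosed.2 ?_⟩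
  intro Z₁ Z₂ h₁ h₂ h
  refine (forall_mem_or_forall_mem isPolyFun_paramMap h₁ h₂ fun y => h (paramMap_mem y)).imp ?_ ?_
  · exact nil2k_subset_of_paramMap_mem h₁
  · exact nil2k_subset_of_paramMap_mem h₂

end Blocks

/-! ### Generic structures lie in the orbits of the families -/

section Congruence

/-- The derivative of the map at `(1, 0)` is `(x, l) ↦ T x * a + a * x + L l`. It is onto by
assumption, so the map is open at that point. In the application `T` is transposition. -/
theorem map_nhds_mul_add_mul {R E : Type*} [NormedRing R] [NormedAlgebra ℂ R] [CompleteSpace R]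
    [NormedAddCommGroup E] [NormedSpace ℂ E] [CompleteSpace E] (T : R →L[ℂ] R) (hT : T 1 = 1)
    (L : E →L[ℂ] R) (a : R) (h : ∀ y, ∃ x l, T x * a + a * x + L l = y) :
    map (fun x : R × E => T x.1 * (a + L x.2) * x.1) (𝓝 (1, 0)) = 𝓝 a := by
  have h₁ : HasStrictFDerivAt (fun x : R × E => T x.1) (T.comp (.fst ℂ R E)) (1, 0) :=
    (T.comp (.fst ℂ R E)).hasStrictFDerivAt
  have h₂ : HasStrictFDerivAt (fun x : R × E => a + L x.2) (L.comp (.snd ℂ R E)) (1, 0) :=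
    (L.comp (.snd ℂ R E)).hasStrictFDerivAt.const_add a
  have h₃ : HasStrictFDerivAt (fun x : R × E => x.1) (.fst ℂ R E) (1, 0) :=
    (ContinuousLinearMap.fst ℂ R E).hasStrictFDerivAt
  have hmap := ((h₁.mul' h₂).mul' h₃).map_nhds_eq_of_surj (by
    refine LinearMap.range_eq_top.2 fun y => ?_
    obtain ⟨x, l, hy⟩ := h y
    refine ⟨(x, l), ?_⟩
    rw [← hy]
    simp [hT]
    abel)
  have hval : T 1 * (a + L 0) * 1 = a := by simp [hT]
  exact hmap.trans (congrArg 𝓝 hval)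

/-- If the tangent space of the congruence orbits in the affine family `A₀ + L l` is everything
at `A₀`, then all matrices near `A₀` are congruent to members of the family. -/
theorem mem_nhds_of_congruence {n r : ℕ} (A₀ : Matrix (Fin n) (Fin n) ℂ)
    (L : (Fin r → ℂ) →ₗ[ℂ] Matrix (Fin n) (Fin n) ℂ)
    (hL : ∀ Y : Matrix (Fin n) (Fin n) ℂ, ∃ (X : Matrix (Fin n) (Fin n) ℂ) (l : Fin r → ℂ),
      X.transpose * A₀ + A₀ * X + L l = Y)
    {S : Set (Matrix (Fin n) (Fin n) ℂ)}
    (hS : ∀ (P : Matrix (Fin n) (Fin n) ℂ) (l : Fin r → ℂ), P.det ≠ 0 →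
      P.transpose * (A₀ + L l) * P ∈ S) : S ∈ 𝓝 A₀ := by
  have hmap : map (fun x : Matrix (Fin n) (Fin n) ℂ × (Fin r → ℂ) =>
      x.1.transpose * (A₀ + L x.2) * x.1) (𝓝 (1, 0)) = 𝓝 A₀ := by
    let := Matrix.linftyOpNormedRing (n := Fin n) (α := ℂ)
    let := Matrix.linftyOpNormedAlgebra (n := Fin n) (R := ℂ) (α := ℂ)
    have : CompleteSpace (Matrix (Fin n) (Fin n) ℂ) := FiniteDimensional.complete ℂ _
    exact map_nhds_mul_add_mul (R := Matrix (Fin n) (Fin n) ℂ)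
      (LinearMap.toContinuousLinearMap
        (Matrix.transposeLinearEquiv (Fin n) (Fin n) ℂ ℂ).toLinearMap)
      Matrix.transpose_one (LinearMap.toContinuousLinearMap L) A₀ hL
  rw [← hmap]
  have hdet : ∀ᶠ x in 𝓝 ((1, 0) : Matrix (Fin n) (Fin n) ℂ × (Fin r → ℂ)), x.1.det ≠ 0 := by
    have : Continuous fun x : Matrix (Fin n) (Fin n) ℂ × (Fin r → ℂ) => x.1.det :=
      continuous_fst.matrix_det
    refine this.continuousAt.eventually_ne ?_
    simp
  exact hdet.mono fun x hx => hS x.1 x.2 hx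

end Congruence

section Families

variable {m k : ℕ} {F : Set (AlgStr (m + k))}

theorem nil2k_subset_orbitClosure (h : ∀ w : Fin m → Fin m → Fin k → ℂ, emb w ∈ orbitClosure F) :
    Nil2k (m + k) k ⊆ orbitClosure F := by
  intro c hc
  obtain ⟨w, hw⟩ := mem_nil2k_iff.1 hc
  obtain ⟨G, H, hGH, rfl⟩ := mem_orbit_iff.1 hw
  exact act_mem_orbitClosure hGH (h w)

/-- This is the block diagonal change of basis with blocks `P⁻¹` and `Q`, written out on tensors. -/
theorem emb_transform_mem {w : Fin m → Fin m → Fin k → ℂ} (hw : emb w ∈ orbitClosure F)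
    {P : Matrix (Fin m) (Fin m) ℂ} {Q : Matrix (Fin k) (Fin k) ℂ} (hP : P.det ≠ 0)
    (hQ : Q.det ≠ 0) :
    emb (fun i j l => ∑ a, ∑ b, ∑ d, w a b d * P a i * P b j * Q l d) ∈ orbitClosure F := by
  have h : blk P⁻¹ 0 0 Q * blk P 0 0 Q⁻¹ = 1 := by
    rw [blk_mul, ← blk_one, Matrix.nonsing_inv_mul _ (Ne.isUnit hP),
      Matrix.mul_nonsing_inv _ (Ne.isUnit hQ)]
    simp
  have := act_mem_orbitClosure h hw
  convert this
  refine ((eq_emb_iff _).2 ⟨?_, ?_, ?_, ?_⟩).symm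
  all_goals
    intro i j l
    simp [act_emb]

theorem emb_congr_mem {w : Fin m → Fin m → Fin k → ℂ} (hw : emb w ∈ orbitClosure F)
    {P : Matrix (Fin m) (Fin m) ℂ} (hP : P.det ≠ 0) :
    emb (fun i j l => (P.transpose * (Matrix.of fun a b => w a b l) * P) i j) ∈ orbitClosure F := by
  have := emb_transform_mem hw hP (Q := 1) (by simp)
  convert this using 5 with i j l
  simp only [Matrix.one_apply, mul_ite, mul_one, mul_zero, Finset.sum_ite_eq, Finset.mem_univ,
    if_true, Matrix.mul_apply, Matrix.transpose_apply, Matrix.of_apply, Finset.sum_mul]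
  rw [Finset.sum_comm]
  exact Finset.sum_congr rfl fun a _ => Finset.sum_congr rfl fun b _ => by ring

theorem emb_map_mem {w : Fin m → Fin m → Fin k → ℂ} (hw : emb w ∈ orbitClosure F)
    {Q : Matrix (Fin k) (Fin k) ℂ} (hQ : Q.det ≠ 0) :
    emb (fun i j => Q.mulVec (w i j)) ∈ orbitClosure F := by
  have := emb_transform_mem hw (P := 1) (by simp) hQ
  convert this using 4 with i j
  funext l
  simp [Matrix.one_apply, Matrix.mulVec, dotProduct, mul_comm]

theorem isPolyFun_emb {σ : Type*} {w : (σ → ℂ) → Fin m → Fin m → Fin k → ℂ}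
    (hw : ∀ i j l, IsPolyFun fun x => w x i j l) (t) : IsPolyFun fun x => emb (w x) t := by
  have := isPolyFun_act_emb (G := fun _ => 1) (H := fun _ => 1) (w := w)
    (fun _ _ => .const _) (fun _ _ => .const _) hw t
  simpa only [act_one] using this

end Families

/-- This carries generic normal forms, known only near one matrix, over to all matrices. -/
theorem forall_matrix_mem {n N : ℕ} {Z : Set (AlgStr N)} (hZ : IsClosed Z)
    {F : Matrix (Fin n) (Fin n) ℂ → AlgStr N}
    (hF : ∀ t, IsPolyFun fun y : Fin n × Fin n → ℂ => F (Matrix.of fun i j => y (i, j)) t)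
    (A₀ : Matrix (Fin n) (Fin n) ℂ) (h : {A | F A ∈ Z} ∈ 𝓝 A₀) (A : Matrix (Fin n) (Fin n) ℂ) :
    F A ∈ Z := by
  have hcont : Continuous fun y : Fin n × Fin n → ℂ => Matrix.of fun i j => y (i, j) :=
    continuous_matrix fun i j => continuous_apply (i, j)
  have hA : Tendsto (fun y : Fin n × Fin n → ℂ => Matrix.of fun i j => y (i, j))
    (𝓝 fun p => A₀ p.1 p.2) (𝓝 A₀) := hcont.tendsto _
  exact mem_of_eventually_mem_of_isPolyFun hZ hF (fun p => A₀ p.1 p.2) (hA h) fun p => A p.1 p.2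

/-! ### One bilinear form in four variables -/

section FourPlusOne

theorem H_eq_emb (l μ : ℂ) : H l μ = emb (m := 4) (k := 1) fun i j _ =>
    !![0, 1, 0, 0; l, 0, 0, 0; 0, 0, 0, 1; 0, 0, μ, 0] i j := by
  refine (eq_emb_iff (m := 4) (k := 1) _).2
    ⟨fun i j l => ?_, fun i j l => ?_, fun i j l => ?_, fun i j l => ?_⟩
  · fin_cases i <;> fin_cases j <;> fin_cases l <;> simp [H, ofTable, e]
  · fin_cases i; fin_cases j <;> fin_cases l <;> simp [H, ofTable, e]
  · fin_cases i <;> fin_cases j <;> fin_cases l <;> simp [H, ofTable, e]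
  · fin_cases i <;> fin_cases j <;> fin_cases l <;> simp [H, ofTable, e]

/-- The base point is λ = 2, μ = 3. The linear system splits into small blocks with determinants 1 +
λ, 1 + μ, λμ - 1 and λ - μ up to sign, all nonzero here; hence the denominators 3, 4, 5. The two
missing directions are those of λ and μ. -/
theorem congruence_four_surjective (Y : Matrix (Fin 4) (Fin 4) ℂ) :
    ∃ (X : Matrix (Fin 4) (Fin 4) ℂ) (l : Fin 2 → ℂ),
      X.transpose * !![0, 1, 0, 0; 2, 0, 0, 0; 0, 0, 0, 1; 0, 0, 3, 0] +
        !![0, 1, 0, 0; 2, 0, 0, 0; 0, 0, 0, 1; 0, 0, 3, 0] * X +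
        !![0, 0, 0, 0; l 0, 0, 0, 0; 0, 0, 0, 0; 0, 0, l 1, 0] = Y := by
  refine ⟨!![Y 0 1, Y 1 1 / 3, Y 2 1 - (Y 1 2 - 2 * Y 2 1), (3 * Y 1 3 - Y 3 1) / 5;
    Y 0 0 / 3, 0, (3 * Y 2 0 - Y 0 2) / 5, Y 0 3 - (Y 3 0 - 2 * Y 0 3);
    Y 3 0 - 2 * Y 0 3, (2 * Y 3 1 - Y 1 3) / 5, Y 2 3, Y 3 3 / 4;
    (2 * Y 0 2 - Y 2 0) / 5, Y 1 2 - 2 * Y 2 1, Y 2 2 / 4, 0],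
    ![Y 1 0 - 2 * Y 0 1, Y 3 2 - 3 * Y 2 3], ?_⟩
  ext i j
  fin_cases i <;> fin_cases j <;>
    simp [Matrix.mul_apply, Fin.sum_univ_four] <;> ring

theorem emb_mem_orbitClosure_V41 (w : Fin 4 → Fin 4 → Fin 1 → ℂ) :
    emb w ∈ orbitClosure (n := 4 + 1) V41 := by
  let L : (Fin 2 → ℂ) →ₗ[ℂ] Matrix (Fin 4) (Fin 4) ℂ :=
    { toFun := fun l => !![0, 0, 0, 0; l 0, 0, 0, 0; 0, 0, 0, 0; 0, 0, l 1, 0]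
      map_add' := fun l l' => by ext i j; fin_cases i <;> fin_cases j <;> simp
      map_smul' := fun r l => by ext i j; fin_cases i <;> fin_cases j <;> simp }
  have hS := mem_nhds_of_congruence
    (S := {A | emb (fun i j (_ : Fin 1) => A i j) ∈ orbitClosure (n := 4 + 1) V41})
    !![0, 1, 0, 0; 2, 0, 0, 0; 0, 0, 0, 1; 0, 0, 3, 0] L congruence_four_surjective (by
      intro P l hP
      have hH : emb (m := 4) (k := 1)
          (fun i j _ => !![0, 1, 0, 0; 2 + l 0, 0, 0, 0; 0, 0, 0, 1; 0, 0, 3 + l 1, 0] i j) ∈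
          orbitClosure (n := 4 + 1) V41 := by
        rw [← H_eq_emb]
        exact subset_orbitClosure (n := 4 + 1) V41 ⟨_, _, rfl⟩
      have hsum : !![0, 1, 0, 0; 2, 0, 0, 0; 0, 0, 0, 1; 0, 0, 3, 0] + L l =
          !![0, 1, 0, 0; 2 + l 0, 0, 0, 0; 0, 0, 0, 1; 0, 0, 3 + l 1, 0] := by
        ext i j; fin_cases i <;> fin_cases j <;> simp [L]
      rw [Set.mem_ofPred_eq, hsum]
      exact emb_congr_mem hH hP)
  have := forall_matrix_mem (isClosed_orbitClosure (n := 4 + 1) V41)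
    (F := fun A => emb (fun i j (_ : Fin 1) => A i j))
    (isPolyFun_emb fun i j _ => .coord (i, j)) _ hS (Matrix.of fun i j => w i j 0)
  convert this using 4 with i j
  funext l
  rw [Subsingleton.elim l 0]
  rfl

end FourPlusOne

/-! ### Pairs of bilinear forms in three variables -/

section ThreePlusTwo

theorem ofPair_eq_emb (a b : Matrix (Fin 3) (Fin 3) ℂ) :
    ofPair a b = emb (m := 3) (k := 2) fun i j => ![a i j, b i j] := by
  refine (eq_emb_iff (m := 3) (k := 2) _).2
    ⟨fun i j l => ?_, fun i j l => ?_, fun i j l => ?_, fun i j l => ?_⟩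
  · fin_cases i <;> fin_cases j <;> fin_cases l <;> simp [ofPair, ofTable, e]
  · fin_cases i <;> fin_cases j <;> fin_cases l <;> simp [ofPair, ofTable, e]
  · fin_cases i <;> fin_cases j <;> fin_cases l <;> simp [ofPair, ofTable, e]
  · fin_cases i <;> fin_cases j <;> fin_cases l <;> simp [ofPair, ofTable, e]

/-- The base point is λ = 2. The system is solvable because 2, 1 + λ and λ - 1 are nonzero; the one
missing direction is that of λ. -/
theorem congruence_three_surjective (Y : Matrix (Fin 3) (Fin 3) ℂ) :
    ∃ (X : Matrix (Fin 3) (Fin 3) ℂ) (l : Fin 1 → ℂ),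
      X.transpose * !![1, 0, 0; 0, 0, 1; 0, 2, 0] + !![1, 0, 0; 0, 0, 1; 0, 2, 0] * X +
        !![0, 0, 0; 0, 0, 0; 0, l 0, 0] = Y := by
  refine ⟨!![Y 0 0 / 2, 2 * Y 1 0 - Y 0 1, 2 * Y 0 2 - Y 2 0; Y 2 0 - Y 0 2, Y 1 2, Y 2 2 / 3;
    Y 0 1 - Y 1 0, Y 1 1 / 3, 0], ![Y 2 1 - 2 * Y 1 2], ?_⟩
  ext i j
  fin_cases i <;> fin_cases j <;>
    simp [Matrix.mul_apply, Fin.sum_univ_three] <;> ring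

theorem emb_pair_mem_of_normalized (l : ℂ) {b : Matrix (Fin 3) (Fin 3) ℂ} (h₀ : b 0 0 = 0)
    (h₂ : b 2 2 ≠ 0) : emb (fun i j => ![!![1, 0, 0; 0, 0, 1; 0, l, 0] i j, b i j]) ∈
      orbitClosure (n := 3 + 2) V32 := by
  have hV : emb (m := 3) (k := 2) (fun i j => ![!![1, 0, 0; 0, 0, 1; 0, l, 0] i j,
      !![0, b 0 1 / b 2 2, b 0 2 / b 2 2; b 1 0 / b 2 2, b 1 1 / b 2 2, b 1 2 / b 2 2;
        b 2 0 / b 2 2, b 2 1 / b 2 2, 1] i j]) ∈ orbitClosure (n := 3 + 2) V32 := by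
    rw [← ofPair_eq_emb]
    exact subset_orbitClosure (n := 3 + 2) V32 ⟨_, _, _, _, _, _, _, _, rfl⟩
  have := emb_map_mem hV (Q := !![1, 0; 0, b 2 2]) (by simpa using h₂)
  convert this using 4 with i j
  funext d
  fin_cases d
  · simp [Matrix.mulVec, dotProduct]
  · fin_cases i <;> fin_cases j <;> simp [Matrix.mulVec, dotProduct, h₀] <;> field_simp

/-- A change of basis in the target subtracts `b 0 0` times the first form from the second. The
first form has entry 1 at `0 0` and 0 at `2 2`, so the former entry of `b` is cleared and the latter
kept. -/
theorem emb_pair_mem_of_ne_zero (l : ℂ) {b : Matrix (Fin 3) (Fin 3) ℂ} (h₂ : b 2 2 ≠ 0) :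
    emb (fun i j => ![!![1, 0, 0; 0, 0, 1; 0, l, 0] i j, b i j]) ∈
      orbitClosure (n := 3 + 2) V32 := by
  have hV := emb_pair_mem_of_normalized l (b := b - b 0 0 • !![1, 0, 0; 0, 0, 1; 0, l, 0])
    (by simp) (by simpa using h₂)
  have := emb_map_mem hV (Q := !![1, 0; b 0 0, 1]) (by simp)
  convert this using 4 with i j
  funext d
  fin_cases d
  · simp [Matrix.mulVec, dotProduct]
  · fin_cases i <;> fin_cases j <;> simp [Matrix.mulVec, dotProduct]

theorem isPolyFun_pair {σ : Type*} {a b : (σ → ℂ) → Matrix (Fin 3) (Fin 3) ℂ}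
    (ha : ∀ i j, IsPolyFun fun x => a x i j) (hb : ∀ i j, IsPolyFun fun x => b x i j) (t) :
    IsPolyFun fun x => emb (fun i j => ![a x i j, b x i j]) t :=
  isPolyFun_emb (fun i j d => by fin_cases d; exacts [ha i j, hb i j]) t

theorem emb_pair_mem (l : ℂ) (b : Matrix (Fin 3) (Fin 3) ℂ) :
    emb (fun i j => ![!![1, 0, 0; 0, 0, 1; 0, l, 0] i j, b i j]) ∈
      orbitClosure (n := 3 + 2) V32 := by
  refine forall_matrix_mem (isClosed_orbitClosure (n := 3 + 2) V32)
    (F := fun b => emb (fun i j => ![!![1, 0, 0; 0, 0, 1; 0, l, 0] i j, b i j]))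
    (isPolyFun_pair (fun _ _ => .const _) fun i j => .coord (i, j)) 1 ?_ b
  have hc : Continuous fun b : Matrix (Fin 3) (Fin 3) ℂ => b 2 2 := continuous_id.matrix_elem 2 2
  have h1 : (1 : Matrix (Fin 3) (Fin 3) ℂ) 2 2 ≠ 0 := by simp
  filter_upwards [hc.continuousAt.eventually_ne h1] with b hb
  exact emb_pair_mem_of_ne_zero l hb

/-- Fix the second form and vary the first. Near the base point the first form is congruent to the
normal form by some `P`; the second is merely carried along, which is harmless since `emb_pair_mem`
allows it to be arbitrary. -/
theorem emb_mem_orbitClosure_V32 (w : Fin 3 → Fin 3 → Fin 2 → ℂ) :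
    emb w ∈ orbitClosure (n := 3 + 2) V32 := by
  let L : (Fin 1 → ℂ) →ₗ[ℂ] Matrix (Fin 3) (Fin 3) ℂ :=
    { toFun := fun l => !![0, 0, 0; 0, 0, 0; 0, l 0, 0]
      map_add' := fun l l' => by ext i j; fin_cases i <;> fin_cases j <;> simp
      map_smul' := fun r l => by ext i j; fin_cases i <;> fin_cases j <;> simp }
  set b : Matrix (Fin 3) (Fin 3) ℂ := Matrix.of fun i j => w i j 1
  have hS := mem_nhds_of_congruence
    (S := {A | emb (fun i j => ![A i j, b i j]) ∈ orbitClosure (n := 3 + 2) V32})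
    !![1, 0, 0; 0, 0, 1; 0, 2, 0] L congruence_three_surjective (by
      intro P l hP
      have hsum : !![1, 0, 0; 0, 0, 1; 0, 2, 0] + L l = !![1, 0, 0; 0, 0, 1; 0, 2 + l 0, 0] := by
        ext i j; fin_cases i <;> fin_cases j <;> simp [L]
      rw [Set.mem_ofPred_eq, hsum]
      have := emb_congr_mem (emb_pair_mem (2 + l 0) (P⁻¹.transpose * b * P⁻¹)) hP
      convert this using 4 with i j
      have hinv : P⁻¹ * P = 1 := Matrix.nonsing_inv_mul _ (Ne.isUnit hP)
      have hb : P.transpose * (P⁻¹.transpose * b * P⁻¹) * P = b := by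
        rw [Matrix.mul_assoc, Matrix.mul_assoc _ P⁻¹, hinv, Matrix.mul_one, ← Matrix.mul_assoc,
          ← Matrix.transpose_mul, hinv, Matrix.transpose_one, Matrix.one_mul]
      funext d
      fin_cases d
      · rfl
      · exact congrFun (congrFun hb.symm i) j)
  have := forall_matrix_mem (isClosed_orbitClosure (n := 3 + 2) V32)
    (F := fun A => emb (fun i j => ![A i j, b i j]))
    (isPolyFun_pair (fun i j => .coord (i, j)) fun _ _ => .const _) _ hS
    (Matrix.of fun i j => w i j 0)
  convert this using 4 with i j
  funext d
  fin_cases d <;> rfl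

end ThreePlusTwo

/-! ### Two generators with three independent products -/

section TwoPlusThree

theorem A133_eq_emb (l : ℂ) : A133 l = emb (m := 2) (k := 3) fun i j d =>
    !![![1, 0, l], ![1, 0, 0]; ![0, 1, 0], ![0, 0, 1]] i j d := by
  refine (eq_emb_iff (m := 2) (k := 3) _).2
    ⟨fun i j l => ?_, fun i j l => ?_, fun i j l => ?_, fun i j l => ?_⟩
  · fin_cases i <;> fin_cases j <;> fin_cases l <;> simp [A133, ofTable, e]
  · fin_cases i <;> fin_cases j <;> fin_cases l <;> simp [A133, ofTable, e]
  · fin_cases i <;> fin_cases j <;> fin_cases l <;> simp [A133, ofTable, e]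
  · fin_cases i <;> fin_cases j <;> fin_cases l <;> simp [A133, ofTable, e]

/-- Structures in which `e₁e₁` is a combination of the other three products of generators, with
coefficients that differ at `e₁e₂` and `e₂e₁`. -/
theorem emb_combination_mem {α β γ : ℂ} (h : α ≠ β) {Q : Matrix (Fin 3) (Fin 3) ℂ}
    (hQ : Q.det ≠ 0) : emb (fun i j => Q.mulVec
      (!![![α, β, γ], ![1, 0, 0]; ![0, 1, 0], ![0, 0, 1]] i j)) ∈
      orbitClosure (n := 2 + 3) V23 := by
  have hδ : α - β ≠ 0 := sub_ne_zero.2 h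
  -- For x = e₁ - βe₂ and f = (α - β)e₂ one computes x² = xf + ((αβ + γ)/(α - β)²) f², the relation
  -- of `A133`. The matrix `P` below expresses e₁, e₂ through x, f, and the inner `Q` expresses xf,
  -- fx, f² through e₁e₂, e₂e₁, e₂e₂.
  have hV : emb (m := 2) (k := 3) (fun i j d => !![![1, 0, (α * β + γ) / (α - β) ^ 2], ![1, 0, 0];
      ![0, 1, 0], ![0, 0, 1]] i j d) ∈ orbitClosure (n := 2 + 3) V23 := by
    rw [← A133_eq_emb]
    exact subset_orbitClosure (n := 2 + 3) V23 ⟨_, rfl⟩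
  have := emb_map_mem (emb_transform_mem hV (P := !![1, 0; β / (α - β), 1 / (α - β)])
    (Q := !![α - β, 0, 0; 0, α - β, 0; -(α - β) * β, -(α - β) * β, (α - β) ^ 2])
    (by simpa using hδ) (by simpa [Matrix.det_fin_three] using hδ)) hQ
  convert this using 4 with i j
  congr 1
  funext d
  fin_cases i <;> fin_cases j <;> fin_cases d <;>
    simp [Fin.sum_univ_two, Fin.sum_univ_three] <;> field_simp <;> ring

theorem emb_mem_orbitClosure_V23 (w : Fin 2 → Fin 2 → Fin 3 → ℂ) :
    emb w ∈ orbitClosure (n := 2 + 3) V23 := by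
  refine mem_of_eventually_mem_of_isPolyFun (σ := Fin 2 × Fin 2 × Fin 3)
    (isClosed_orbitClosure (n := 2 + 3) V23) (F := fun y => emb fun i j d => y (i, j, d))
    (isPolyFun_emb fun i j d => .coord _)
    (fun p => !![![1, 0, 0], ![1, 0, 0]; ![0, 1, 0], ![0, 0, 1]] p.1 p.2.1 p.2.2) ?_
    fun p => w p.1 p.2.1 p.2.2
  let M : (Fin 2 × Fin 2 × Fin 3 → ℂ) → Matrix (Fin 3) (Fin 3) ℂ := fun y =>
    Matrix.of fun d c => ![y (0, 1, d), y (1, 0, d), y (1, 1, d)] c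
  -- By Cramer's rule `u y` is `(M y).det` times the coefficients of e₁e₁ in terms of e₁e₂, e₂e₁,
  -- e₂e₂. Avoiding division keeps it continuous everywhere.
  let u : (Fin 2 × Fin 2 × Fin 3 → ℂ) → Fin 3 → ℂ := fun y =>
    (M y).adjugate.mulVec fun d => y (0, 0, d)
  have hM : Continuous M := by
    refine continuous_matrix fun d c => ?_
    fin_cases c <;> exact continuous_apply _
  have hu : Continuous u := hM.matrix_adjugate.matrix_mulVec
    (continuous_pi fun d => continuous_apply _)
  set y₀ : Fin 2 × Fin 2 × Fin 3 → ℂ :=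
    fun p => !![![1, 0, 0], ![1, 0, 0]; ![0, 1, 0], ![0, 0, 1]] p.1 p.2.1 p.2.2
  have hM₀ : M y₀ = 1 := by
    ext d c
    fin_cases d <;> fin_cases c <;> simp [M, y₀]
  have h₁ : ∀ᶠ y in 𝓝 y₀, (M y).det ≠ 0 := by
    refine hM.matrix_det.continuousAt.eventually_ne ?_
    simp [hM₀]
  have h₂ : ∀ᶠ y in 𝓝 y₀, u y 0 - u y 1 ≠ 0 := by
    have : Continuous fun y => u y 0 - u y 1 :=
      ((continuous_apply 0).comp hu).sub ((continuous_apply 1).comp hu)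
    refine this.continuousAt.eventually_ne ?_
    simp only [u, hM₀, Matrix.adjugate_one, Matrix.one_mulVec]
    simp [y₀]
  filter_upwards [h₁, h₂] with y hy₁ hy₂
  have hne : (M y).det⁻¹ * u y 0 ≠ (M y).det⁻¹ * u y 1 := fun h =>
    hy₂ (sub_eq_zero.2 (mul_left_cancel₀ (inv_ne_zero hy₁) h))
  have := emb_combination_mem (γ := (M y).det⁻¹ * u y 2) hne hy₁
  convert this using 4 with i j
  have hsol : (M y).mulVec ![(M y).det⁻¹ * u y 0, (M y).det⁻¹ * u y 1, (M y).det⁻¹ * u y 2] =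
      fun d => y (0, 0, d) := by
    have hv : ![(M y).det⁻¹ * u y 0, (M y).det⁻¹ * u y 1, (M y).det⁻¹ * u y 2] =
        (M y).det⁻¹ • u y := by
      funext d; fin_cases d <;> rfl
    rw [hv, Matrix.mulVec_smul]
    simp only [u, Matrix.mulVec_mulVec, Matrix.mul_adjugate, Matrix.smul_mulVec, Matrix.one_mulVec]
    rw [smul_smul, inv_mul_cancel₀ hy₁, one_smul]
  fin_cases i <;> fin_cases j
  · exact hsol.symm
  all_goals
    funext d
    simp [Matrix.mulVec, dotProduct, Fin.sum_univ_three, M]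

end TwoPlusThree

/-! ### Irreducible components -/

section Components

theorem isIrreducible_of_image_val {X : Type*} [TopologicalSpace X] {V : Set X} {Z : Set V}
    (h : IsIrreducible (Subtype.val '' Z)) : IsIrreducible Z := by
  refine ⟨Set.image_nonempty.1 h.1, ?_⟩
  rintro _ _ ⟨u, hu, rfl⟩ ⟨v, hv, rfl⟩ ⟨x, hx, hxu⟩ ⟨y, hy, hyv⟩
  obtain ⟨_, ⟨z, hz, rfl⟩, hzu, hzv⟩ := h.2 u v hu hv ⟨x, ⟨x, hx, rfl⟩, hxu⟩ ⟨y, ⟨y, hy, rfl⟩, hyv⟩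
  exact ⟨z, hz, hzu, hzv⟩

/-- If a set is the union of finitely many closed irreducible sets without inclusions among
them, then these are its irreducible components. -/
theorem components_eq {n : ℕ} {V : Set (AlgStr n)} (T : Finset (Set (AlgStr n)))
    (hV : V = ⋃₀ T) (hcl : ∀ Z ∈ T, IsClosed Z) (hirr : ∀ Z ∈ T, IsIrreducible Z)
    (hinc : ∀ Z ∈ T, ∀ Z' ∈ T, Z ⊆ Z' → Z = Z') : components V = T := by
  have hsub : ∀ Z ∈ T, Z ⊆ V := fun Z hZ => hV ▸ Set.subset_sUnion_of_mem hZ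
  have hle : ∀ Y : Set V, IsIrreducible Y → ∃ Z ∈ T, Subtype.val '' Y ⊆ Z := fun Y hY =>
    isIrreducible_iff_sUnion_isClosed.1 (hY.image _ continuous_subtype_val.continuousOn) T hcl
      ((Subtype.coe_image_subset V Y).trans hV.le)
  have himg : ∀ Z ∈ T, Subtype.val '' (Subtype.val ⁻¹' Z : Set V) = Z := fun Z hZ => by
    rw [Subtype.image_preimage_coe, Set.inter_eq_right.2 (hsub Z hZ)]
  have hirr' : ∀ Z ∈ T, IsIrreducible (Subtype.val ⁻¹' Z : Set V) := fun Z hZ =>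
    isIrreducible_of_image_val (by rw [himg Z hZ]; exact hirr Z hZ)
  ext S
  constructor
  · rintro ⟨Y, hY, rfl⟩
    obtain ⟨Z, hZ, hYZ⟩ := hle Y hY.1
    have hZY := hY.2 (hirr' Z hZ) (Set.image_subset_iff.1 hYZ)
    have : Subtype.val '' Y = Z := by
      refine hYZ.antisymm ?_
      rw [← himg Z hZ]
      exact Set.image_mono hZY
    simpa only [this, Finset.mem_coe] using hZ
  · intro hS
    refine ⟨Subtype.val ⁻¹' S, ⟨hirr' S hS, fun Y hY hSY => ?_⟩, himg S hS⟩
    obtain ⟨Z, hZ, hYZ⟩ := hle Y hY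
    have hSZ : S ⊆ Z := by
      rw [← himg S hS]
      exact (Set.image_mono hSY).trans hYZ
    rw [hinc S hS Z hZ hSZ]
    exact Set.image_subset_iff.1 hYZ

end Components

/-! ### Dimensions of squares and annihilators -/

section Invariants

variable {m k : ℕ} {w : Fin m → Fin m → Fin k → ℂ}

theorem finrank_square_emb (h : ∀ l, ∃ i j, w i j = Pi.single l 1) :
    Module.finrank ℂ (square (emb w)) = k := by
  refine le_antisymm (emb_mem_nil2k w).2.1 ?_
  refine (finrank_range_lastIncl (m := m) (k := k)).symm.trans_le (Submodule.finrank_mono ?_)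
  rw [LinearMap.range_eq_map, ← (Pi.basisFun ℂ (Fin k)).span_eq, Submodule.map_span,
    Submodule.span_le]
  rintro _ ⟨_, ⟨l, rfl⟩, rfl⟩
  obtain ⟨i, j, hij⟩ := h l
  refine Submodule.subset_span ⟨Pi.single (Fin.castAdd k i) 1, Pi.single (Fin.castAdd k j) 1, ?_⟩
  rw [mul_emb, lastIncl_apply, Pi.basisFun_apply, ← hij]
  congr 1
  funext d
  simp [Pi.single_apply]

/-- If one component form is nondegenerate, an annihilating vector has its first m coordinates in
the left kernel of that form, so they vanish. -/
theorem finrank_ann_emb (l : Fin k) (h : (Matrix.of fun i j => w i j l).det ≠ 0) :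
    Module.finrank ℂ (ann (emb w)) ≤ k := by
  conv_rhs => rw [← finrank_range_lastIncl (m := m) (k := k)]
  refine Submodule.finrank_mono fun x hx => ?_
  have hx0 : (fun i => x (Fin.castAdd k i)) = 0 := by
    refine Matrix.eq_zero_of_vecMul_eq_zero h ?_
    funext j
    have := congrFun (hx (Pi.single (Fin.castAdd k j) 1)).1 (Fin.natAdd m l)
    rw [mul_emb] at this
    simpa [Pi.single_apply, Matrix.vecMul, dotProduct, mul_comm] using this
  refine ⟨fun d => x (Fin.natAdd m d), ?_⟩
  rw [lastIncl_apply]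
  funext d
  refine Fin.addCases (fun d => ?_) (fun d => ?_) d
  · simpa using (congrFun hx0 d).symm
  · simp

theorem finrank_square_of_mem_V23 {c : AlgStr 5} (hc : c ∈ V23) :
    Module.finrank ℂ (square c) = 3 := by
  obtain ⟨l, rfl⟩ := hc
  rw [A133_eq_emb]
  refine finrank_square_emb (m := 2) (k := 3) fun d => ?_
  fin_cases d
  · exact ⟨0, 1, by funext d; fin_cases d <;> rfl⟩
  · exact ⟨1, 0, by funext d; fin_cases d <;> rfl⟩
  · exact ⟨1, 1, by funext d; fin_cases d <;> rfl⟩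

theorem finrank_square_of_mem_V32 {c : AlgStr 5} (hc : c ∈ V32) :
    Module.finrank ℂ (square c) = 2 := by
  obtain ⟨l, m₁, m₂, m₃, m₄, m₅, m₆, m₇, rfl⟩ := hc
  rw [ofPair_eq_emb]
  refine finrank_square_emb (m := 3) (k := 2) fun d => ?_
  fin_cases d
  · exact ⟨0, 0, by funext d; fin_cases d <;> rfl⟩
  · exact ⟨2, 2, by funext d; fin_cases d <;> rfl⟩

theorem finrank_square_of_mem_V41 {c : AlgStr 5} (hc : c ∈ V41) :
    Module.finrank ℂ (square c) = 1 := by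
  obtain ⟨l, μ, rfl⟩ := hc
  rw [H_eq_emb]
  refine finrank_square_emb (m := 4) (k := 1) fun d => ⟨0, 1, ?_⟩
  fin_cases d
  funext d
  fin_cases d
  rfl

theorem V23_subset : V23 ⊆ Nil2k 5 3 := by
  rintro _ ⟨l, rfl⟩
  rw [A133_eq_emb]
  exact emb_mem_nil2k (m := 2) (k := 3) _

theorem V32_subset : V32 ⊆ Nil2k 5 2 := by
  rintro _ ⟨l, m₁, m₂, m₃, m₄, m₅, m₆, m₇, rfl⟩
  rw [ofPair_eq_emb]
  exact emb_mem_nil2k (m := 3) (k := 2) _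

theorem V41_subset : V41 ⊆ Nil2k 5 1 := by
  rintro _ ⟨l, μ, rfl⟩
  rw [H_eq_emb]
  exact emb_mem_nil2k (m := 4) (k := 1) _

/-- For λ = 1 the first form is nondegenerate, so the annihilator is too small for k = 3. -/
theorem exists_mem_nil2k_two : ∃ c ∈ Nil2k 5 2, c ∉ Nil2k 5 3 := by
  refine ⟨_, V32_subset ⟨1, 0, 0, 0, 0, 0, 0, 0, rfl⟩, fun h => ?_⟩
  have h3 := h.2.2
  rw [ofPair_eq_emb] at h3
  have h2 := finrank_ann_emb (m := 3) (k := 2) (w := fun i j => ![!![1, 0, 0; 0, 0, 1; 0, 1, 0] i j,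
    !![0, 0, 0; 0, 0, 0; 0, 0, 1] i j]) 0 (by simp [Matrix.det_fin_three])
  exact absurd (h3.trans h2) (by norm_num)

theorem exists_mem_nil2k_one : ∃ c ∈ Nil2k 5 1, ∀ k, 2 ≤ k → c ∉ Nil2k 5 k := by
  refine ⟨_, V41_subset ⟨1, 1, rfl⟩, fun k hk h => ?_⟩
  have h3 := hk.trans h.2.2
  rw [H_eq_emb] at h3
  have h2 := finrank_ann_emb (m := 4) (k := 1) (w := fun i j _ =>
    !![0, 1, 0, 0; 1, 0, 0, 0; 0, 0, 0, 1; 0, 0, 1, 0] i j) 0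
    (by simp [Matrix.det_succ_row_zero, Fin.sum_univ_succ, Fin.succAbove])
  exact absurd (h3.trans h2) (by norm_num)

theorem not_mem_nil2k_of_mem_V23 {c : AlgStr 5} (hc : c ∈ V23) {k : ℕ} (hk : k < 3) :
    c ∉ Nil2k 5 k := fun h => by
  have := h.2.1
  rw [finrank_square_of_mem_V23 hc] at this
  omega

theorem not_mem_nil2k_of_mem_V32 {c : AlgStr 5} (hc : c ∈ V32) {k : ℕ} (hk : k < 2) :
    c ∉ Nil2k 5 k := fun h => by
  have := h.2.1
  rw [finrank_square_of_mem_V32 hc] at this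
  omega

theorem orbitClosure_subset_nil2k {n k : ℕ} {F : Set (AlgStr n)} (h : F ⊆ Nil2k n k) :
    orbitClosure F ⊆ Nil2k n k := by
  refine closure_minimal (Set.iUnion₂_subset fun c hc c' hc' => ?_) (isClosed_nil2k k)
  exact mem_nil2k_of_mem_orbit (h hc) hc'

theorem orbitClosure_V23 : orbitClosure V23 = Nil2k 5 3 :=
  (orbitClosure_subset_nil2k V23_subset).antisymm
    (nil2k_subset_orbitClosure (m := 2) (k := 3) emb_mem_orbitClosure_V23)

theorem orbitClosure_V32 : orbitClosure V32 = Nil2k 5 2 :=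
  (orbitClosure_subset_nil2k V32_subset).antisymm
    (nil2k_subset_orbitClosure (m := 3) (k := 2) emb_mem_orbitClosure_V32)

theorem orbitClosure_V41 : orbitClosure V41 = Nil2k 5 1 :=
  (orbitClosure_subset_nil2k V41_subset).antisymm
    (nil2k_subset_orbitClosure (m := 4) (k := 1) emb_mem_orbitClosure_V41)

/-- The exact locus lies between the union of orbits and `Nil2k`: dim A² is constant on orbits, and
A² ⊆ Ann A gives k ≤ dim Ann A. -/
theorem orbitClosure_eq_closure {n k : ℕ} {F : Set (AlgStr n)} (h : orbitClosure F = Nil2k n k)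
    (hF : ∀ c ∈ F, Module.finrank ℂ (square c) = k) :
    orbitClosure F = closure {c | c ∈ Nil2 n ∧ Module.finrank ℂ (square c) = k} := by
  refine Set.Subset.antisymm (closure_mono (Set.iUnion₂_subset fun c hc c' hc' => ?_))
    (closure_minimal ?_ (isClosed_orbitClosure F))
  · have hc₀ : c ∈ Nil2k n k := h ▸ subset_orbitClosure F hc
    exact ⟨mem_nil2_of_mem_orbit hc₀.1 hc', (finrank_square_of_mem_orbit hc').trans (hF c hc)⟩
  · rintro c ⟨hc, hk⟩
    rw [h]
    exact ⟨hc, hk.le, hk ▸ Submodule.finrank_mono (mem_nil2_iff_square_le_ann.1 hc)⟩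

/-- The m² products of generators span the square; this excludes squares of dimension 4 and 5 when n
= 5. -/
theorem finrank_square_emb_le (w : Fin m → Fin m → Fin k → ℂ) :
    Module.finrank ℂ (square (emb w)) ≤ m * m := by
  let v : Fin m × Fin m → Vec (m + k) := fun p => lastIncl m k (w p.1 p.2)
  have h : square (emb w) ≤ Submodule.span ℂ (Set.range v) := by
    refine Submodule.span_le.2 ?_
    rintro _ ⟨x, y, rfl⟩
    have : mul (emb w) x y =
        ∑ i, ∑ j, (x (Fin.castAdd k i) * y (Fin.castAdd k j)) • v (i, j) := by
      rw [mul_emb, ← lastIncl_apply]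
      simp only [v, ← map_smul, ← map_sum]
      congr 1
      funext l
      simp only [Finset.sum_apply, Pi.smul_apply, smul_eq_mul]
      exact Finset.sum_congr rfl fun i _ => Finset.sum_congr rfl fun j _ => by ring
    rw [this]
    exact Submodule.sum_mem _ fun i _ => Submodule.sum_mem _ fun j _ =>
      Submodule.smul_mem _ _ (Submodule.subset_span ⟨(i, j), rfl⟩)
  refine (Submodule.finrank_mono h).trans ((finrank_range_le_card v).trans ?_)
  simp

theorem finrank_square_le_of_mem_nil2k {c : AlgStr (m + k)} (hc : c ∈ Nil2k (m + k) k) :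
    Module.finrank ℂ (square c) ≤ m * m := by
  obtain ⟨w, hw⟩ := mem_nil2k_iff.1 hc
  rw [finrank_square_of_mem_orbit hw]
  exact finrank_square_emb_le w

theorem nil2_eq_union : Nil2 5 = Nil2k 5 3 ∪ (Nil2k 5 2 ∪ Nil2k 5 1) := by
  refine Set.Subset.antisymm (fun c hc => ?_) ?_
  · have hk : c ∈ Nil2k 5 (Module.finrank ℂ (square c)) :=
      ⟨hc, le_rfl, Submodule.finrank_mono (mem_nil2_iff_square_le_ann.1 hc)⟩
    have h5 : Module.finrank ℂ (square c) ≤ 5 := by simpa using Submodule.finrank_le (square c)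
    generalize hs : Module.finrank ℂ (square c) = s at hk h5
    interval_cases s
    · refine .inr (.inr ⟨hc, by omega, ?_⟩)
      have hbot := Submodule.finrank_eq_zero.1 hs
      have htop : ann c = ⊤ := by
        refine eq_top_iff.2 fun x _ y => ?_
        have h : ∀ x y, mul c x y = 0 := fun x y =>
          (Submodule.mem_bot ℂ).1 (hbot ▸ Submodule.subset_span ⟨x, y, rfl⟩)
        exact ⟨h x y, h y x⟩
      rw [htop, finrank_top, Module.finrank_fin_fun]
      omega
    · exact .inr (.inr hk)
    · exact .inr (.inl hk)
    · exact .inl hk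
    · have := finrank_square_le_of_mem_nil2k (m := 1) (k := 4) hk
      exact absurd (hs.symm.trans_le this) (by norm_num)
    · have := finrank_square_le_of_mem_nil2k (m := 0) (k := 5) hk
      exact absurd (hs.symm.trans_le this) (by norm_num)
  · rintro c (hc | hc | hc) <;> exact hc.1

/-- A larger k admits algebras whose square is too big for a smaller one, and a smaller k admits
algebras whose annihilator is too small for a larger one. -/
theorem nil2k_not_subset {k k' : ℕ} (hk : k ∈ ({3, 2, 1} : Set ℕ)) (hk' : k' ∈ ({3, 2, 1} : Set ℕ))
    (h : Nil2k 5 k ⊆ Nil2k 5 k') : k = k' := by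
  have h₃ : A133 0 ∈ V23 := ⟨0, rfl⟩
  obtain ⟨c₂, hc₂, hc₂'⟩ := exists_mem_nil2k_two
  obtain ⟨c₁, hc₁, hc₁'⟩ := exists_mem_nil2k_one
  simp only [Set.mem_insert_iff, Set.mem_singleton_iff] at hk hk'
  rcases hk with rfl | rfl | rfl <;> rcases hk' with rfl | rfl | rfl
  · rfl
  · exact absurd (h (V23_subset h₃)) (not_mem_nil2k_of_mem_V23 h₃ (by norm_num))
  · exact absurd (h (V23_subset h₃)) (not_mem_nil2k_of_mem_V23 h₃ (by norm_num))
  · exact absurd (h hc₂) hc₂'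
  · rfl
  · have h₂ : ofPair _ _ ∈ V32 := ⟨0, 0, 0, 0, 0, 0, 0, 0, rfl⟩
    exact absurd (h (V32_subset h₂)) (not_mem_nil2k_of_mem_V32 h₂ (by norm_num))
  · exact absurd (h hc₁) (hc₁' 3 (by norm_num))
  · exact absurd (h hc₁) (hc₁' 2 le_rfl)
  · rfl

theorem nil2k_injOn : Set.InjOn (Nil2k 5) {3, 2, 1} := fun _ hk _ hk' h =>
  nil2k_not_subset hk hk' h.le

theorem components_nil2 : components (Nil2 5) = {Nil2k 5 3, Nil2k 5 2, Nil2k 5 1} := by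
  classical
  have h := components_eq (V := Nil2 5) {Nil2k 5 3, Nil2k 5 2, Nil2k 5 1}
    (by simpa using nil2_eq_union) (by simp [isClosed_nil2k]) ?_ ?_
  · simpa using h
  · simp only [Finset.mem_insert, Finset.mem_singleton, forall_eq_or_imp, forall_eq]
    exact ⟨isIrreducible_nil2k (m := 2) (k := 3), isIrreducible_nil2k (m := 3) (k := 2),
      isIrreducible_nil2k (m := 4) (k := 1)⟩
  · have himg : ∀ Z ∈ ({Nil2k 5 3, Nil2k 5 2, Nil2k 5 1} : Finset (Set (AlgStr 5))),
        ∃ k ∈ ({3, 2, 1} : Set ℕ), Nil2k 5 k = Z := by simp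
    intro Z hZ Z' hZ' hsub
    obtain ⟨k, hk, rfl⟩ := himg Z hZ
    obtain ⟨k', hk', rfl⟩ := himg Z' hZ'
    rw [nil2k_not_subset hk hk' hsub]

theorem ncard_components_nil2 : (components (Nil2 5)).ncard = 3 := by
  have : components (Nil2 5) = Nil2k 5 '' {3, 2, 1} := by
    rw [components_nil2]; simp [Set.image_insert_eq]
  rw [this, nil2k_injOn.ncard_image]
  rw [Set.ncard_eq_toFinset_card']
  rfl

end Invariants

/-! ### Dimension -/

section KrullDim

theorem ringKrullDim_le_of_isIntegral {R S : Type*} [CommRing R] [CommRing S] (f : R →+* S)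
    (hf : f.IsIntegral) : ringKrullDim S ≤ ringKrullDim R := by
  algebraize [f]
  refine Order.krullDim_le_of_strictMono (PrimeSpectrum.comap (algebraMap R S)) fun P Q hPQ => ?_
  exact Ideal.IsIntegral.comap_lt_comap (I := P.asIdeal) (J := Q.asIdeal) hPQ

/-- Injectivity lets the bottom prime of a chain be lifted, and going-up lifts the rest. -/
theorem le_ringKrullDim_of_isIntegral {R S : Type*} [CommRing R] [CommRing S] (f : R →+* S)
    (hf : f.IsIntegral) (hinj : Function.Injective f) : ringKrullDim R ≤ ringKrullDim S := by
  algebraize [f]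
  refine iSup_le fun l => ?_
  obtain ⟨Q, -, hQ, hQl⟩ := Ideal.exists_ideal_over_prime_of_isIntegral
    (RelSeries.head l).asIdeal (⊥ : Ideal S) (by
      intro x hx
      have : x = 0 := hinj (by rw [map_zero]; exact hx)
      simp [this])
  have : Q.LiesOver (RelSeries.head l).asIdeal := ⟨hQl.symm⟩
  obtain ⟨L, hL, -⟩ := Ideal.exists_ltSeries_of_hasGoingUp (S := S) l Q
  rw [← hL]
  exact le_iSup (fun L : LTSeries (PrimeSpectrum S) => (L.length : WithBot ℕ∞)) L

theorem ringKrullDim_mvPolynomial_complex (s : ℕ) :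
    ringKrullDim (MvPolynomial (Fin s) ℂ) = s := by
  rw [MvPolynomial.ringKrullDim_of_isNoetherianRing]
  simp

variable {n : ℕ}

theorem mem_idealOf_iff {V : Set (AlgStr n)} {p : MvPolynomial (Fin n × Fin n × Fin n) ℂ} :
    p ∈ idealOf V ↔ ∀ c ∈ V, MvPolynomial.eval (fun t => c t) p = 0 := Iff.rfl

/-- If any `s > d` polynomials are algebraically dependent on `V`, then `dim V ≤ d`. -/
theorem varietyDim_le {V : Set (AlgStr n)} (hV : V.Nonempty) (d : ℕ)
    (h : ∀ s, d < s → ∀ f : Fin s → MvPolynomial (Fin n × Fin n × Fin n) ℂ,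
      ∃ P : MvPolynomial (Fin s) ℂ, P ≠ 0 ∧ MvPolynomial.aeval f P ∈ idealOf V) :
    varietyDim V ≤ d := by
  have hne : idealOf V ≠ ⊤ := by
    rw [Ne, Ideal.eq_top_iff_one, mem_idealOf_iff]
    obtain ⟨c, hc⟩ := hV
    exact fun h => one_ne_zero ((map_one _).symm.trans (h c hc))
  have : Nontrivial (MvPolynomial (Fin n × Fin n × Fin n) ℂ ⧸ idealOf V) :=
    Ideal.Quotient.nontrivial_iff.2 hne
  -- Noether normalization: `s` is the dimension. If `s > d`, lifting the `s` independent generators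
  -- gives polynomials dependent on `V`, contradicting injectivity of `g`.
  obtain ⟨s, g, hg, hint⟩ := exists_integral_inj_algHom_of_fg ℂ
    (MvPolynomial (Fin n × Fin n × Fin n) ℂ ⧸ idealOf V)
  refine (ringKrullDim_le_of_isIntegral g.toRingHom hint).trans ?_
  rw [ringKrullDim_mvPolynomial_complex]
  have hs : s ≤ d := by
    by_contra! hs
    choose f hf using fun i => Ideal.Quotient.mk_surjective (g (MvPolynomial.X i))
    obtain ⟨P, hP, hPV⟩ := h s hs f
    refine hP (hg ?_)
    have hcomp : g = (Ideal.Quotient.mkₐ ℂ (idealOf V)).comp (MvPolynomial.aeval f) := by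
      refine MvPolynomial.algHom_ext fun i => ?_
      simp [hf]
    rw [map_zero, hcomp, AlgHom.comp_apply, Ideal.Quotient.mkₐ_eq_mk]
    exact Ideal.Quotient.eq_zero_iff_mem.2 hPV
  exact_mod_cast hs

variable {σ : Type} {F : (σ → ℂ) → AlgStr n}

theorem exists_pullback (hF : ∀ t, IsPolyFun fun y => F y t) :
    ∃ φ : MvPolynomial (Fin n × Fin n × Fin n) ℂ →ₐ[ℂ] MvPolynomial σ ℂ,
      ∀ p y, MvPolynomial.eval y (φ p) = MvPolynomial.eval (fun t => F y t) p := by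
  choose q hq using hF
  refine ⟨MvPolynomial.aeval q, fun p y => ?_⟩
  induction p using MvPolynomial.induction_on with
  | C a => simp
  | add p q hp hq => simp only [map_add, hp, hq]
  | mul_X p i hp => simp only [map_mul, hp, MvPolynomial.aeval_X, hq, MvPolynomial.eval_X]

/-- Polynomials are dependent on the image of an affine space of smaller dimension. -/
theorem exists_relation_on_image [Fintype σ] (hF : ∀ t, IsPolyFun fun y => F y t) {s : ℕ}
    (hs : Fintype.card σ < s) (f : Fin s → MvPolynomial (Fin n × Fin n × Fin n) ℂ) :
    ∃ P : MvPolynomial (Fin s) ℂ, P ≠ 0 ∧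
      ∀ y, MvPolynomial.eval (fun t => F y t) (MvPolynomial.aeval f P) = 0 := by
  obtain ⟨φ, hφ⟩ := exists_pullback hF
  have hdep : ¬ AlgebraicIndependent ℂ fun i => φ (f i) := fun h => by
    have := h.cardinalMk_le_trdeg
    rw [MvPolynomial.trdeg_of_isDomain] at this
    simp at this
    omega
  rw [algebraicIndependent_iff] at hdep
  push Not at hdep
  obtain ⟨P, hP₀, hP⟩ := hdep
  refine ⟨P, hP, fun y => ?_⟩
  have hcomp : φ (MvPolynomial.aeval f P) = MvPolynomial.aeval (fun i => φ (f i)) P := by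
    rw [← AlgHom.comp_apply]
    congr 1
    exact MvPolynomial.algHom_ext fun i => by simp
  rw [← hφ, hcomp, hP₀, map_zero]

/-- If the projection of a parametrized subset of `V` to `d` coordinates is dominant, then
`d ≤ dim V`. -/
theorem le_varietyDim {V : Set (AlgStr n)} (hF : ∀ t, IsPolyFun fun y => F y t)
    (hV : ∀ y, F y ∈ V) {τ : Type} [Fintype τ] (t : τ → Fin n × Fin n × Fin n)
    (h : ∀ P : MvPolynomial τ ℂ, (∀ y, MvPolynomial.eval (fun i => F y (t i)) P = 0) → P = 0) :
    (Fintype.card τ : WithBot ℕ∞) ≤ varietyDim V := by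
  obtain ⟨φ, hφ⟩ := exists_pullback hF
  have hle : idealOf V ≤ RingHom.ker φ := fun p hp => by
    refine (RingHom.mem_ker).2 (MvPolynomial.funext fun y => ?_)
    rw [hφ, map_zero]
    exact hp _ (hV y)
  refine le_trans ?_ (ringKrullDim_le_of_surjective (Ideal.Quotient.factor hle)
    (Ideal.Quotient.factor_surjective hle))
  -- Passing to the closure of the image makes the coordinate ring a domain, where transcendence
  -- degree can be compared with dimension.
  have hprime : (RingHom.ker φ).IsPrime := RingHom.ker_isPrime φ
  obtain ⟨s, g, hg, hint⟩ := exists_integral_inj_algHom_of_fg ℂ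
    (MvPolynomial (Fin n × Fin n × Fin n) ℂ ⧸ RingHom.ker φ)
  refine le_trans ?_ (le_ringKrullDim_of_isIntegral g.toRingHom hint hg)
  rw [ringKrullDim_mvPolynomial_complex]
  have hind : AlgebraicIndependent ℂ fun i =>
      Ideal.Quotient.mkₐ ℂ (RingHom.ker φ) (MvPolynomial.X (t i)) := by
    rw [algebraicIndependent_iff]
    intro P hP
    refine h P fun y => ?_
    have hcomp : MvPolynomial.aeval (fun i =>
        Ideal.Quotient.mkₐ ℂ (RingHom.ker φ) (MvPolynomial.X (t i))) P =
        Ideal.Quotient.mkₐ ℂ (RingHom.ker φ) (MvPolynomial.rename t P) := by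
      rw [← AlgHom.comp_apply]
      congr 1
      exact MvPolynomial.algHom_ext fun i => by simp
    rw [hcomp, Ideal.Quotient.mkₐ_eq_mk, Ideal.Quotient.eq_zero_iff_mem, RingHom.mem_ker] at hP
    have := hφ (MvPolynomial.rename t P) y
    rw [hP, map_zero, MvPolynomial.eval_rename] at this
    exact this.symm
  have hcard := hind.lift_cardinalMk_le_trdeg
  -- Integrality over the image of `g` bounds the transcendence degree by the number `s` of
  -- generators.
  have halg : Algebra.IsAlgebraic (Algebra.adjoin ℂ (Set.range fun i => g (MvPolynomial.X i)))
      (MvPolynomial (Fin n × Fin n × Fin n) ℂ ⧸ RingHom.ker φ) := by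
    set S := Algebra.adjoin ℂ (Set.range fun i => g (MvPolynomial.X i))
    have hgS : ∀ p, g p ∈ S := fun p => by
      induction p using MvPolynomial.induction_on with
      | C a =>
        rw [← MvPolynomial.algebraMap_eq, AlgHom.commutes]
        exact S.algebraMap_mem a
      | add p q hp hq => rw [map_add]; exact add_mem hp hq
      | mul_X p i hp => rw [map_mul]; exact mul_mem hp (Algebra.subset_adjoin ⟨i, rfl⟩)
    refine ⟨fun b => IsIntegral.isAlgebraic ?_⟩
    obtain ⟨p, hp, hpb⟩ := hint b
    refine ⟨p.map (g.codRestrict S hgS).toRingHom, hp.map _, ?_⟩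
    rw [Polynomial.eval₂_map]
    exact hpb
  have htr := Algebra.IsAlgebraic.trdeg_le_cardinalMk ℂ (Set.range fun i => g (MvPolynomial.X i))
  have hle := (hcard.trans (Cardinal.lift_le.2 htr)).trans
    (Cardinal.lift_le.2 Cardinal.mk_range_le)
  have : Fintype.card τ ≤ s := by simpa using hle
  exact_mod_cast this

end KrullDim

/-! ### The dimension is 24 -/

section Nil2Dim

theorem paramMap_natAdd {m k : ℕ} (y : Param m k → ℂ) (i j l) :
    paramMap y (Fin.castAdd k i, Fin.castAdd k j, Fin.natAdd m l) = y (.inr (i, j, l)) := by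
  simp [paramMap, unipotentAct, act_emb, Matrix.one_apply]

theorem paramMap_castAdd {m k : ℕ} (y : Param m k → ℂ) (i j l) :
    paramMap y (Fin.castAdd k i, Fin.castAdd k j, Fin.castAdd k l) =
      ∑ d, y (.inr (i, j, d)) * y (.inl (l, d)) := by
  simp [paramMap, unipotentAct, act_emb, Matrix.one_apply]

theorem varietyDim_nil2_le : varietyDim (Nil2 5) ≤ 24 := by
  refine varietyDim_le (n := 5) ⟨_, (V23_subset ⟨0, rfl⟩).1⟩ 24 fun s hs f => ?_
  obtain ⟨P₁, hP₁, h₁⟩ := exists_relation_on_image (σ := Param 2 3) (F := paramMap)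
    isPolyFun_paramMap (lt_of_le_of_lt (by simp) hs) f
  obtain ⟨P₂, hP₂, h₂⟩ := exists_relation_on_image (σ := Param 3 2) (F := paramMap)
    isPolyFun_paramMap (lt_of_le_of_lt (by simp) hs) f
  obtain ⟨P₃, hP₃, h₃⟩ := exists_relation_on_image (σ := Param 4 1) (F := paramMap)
    isPolyFun_paramMap (lt_of_le_of_lt (by simp) hs) f
  have hcl : ∀ P : MvPolynomial (Fin s) ℂ, IsClosed {c : AlgStr 5 |
      MvPolynomial.eval (fun t => c t) (MvPolynomial.aeval f P) = 0} := fun P =>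
    isClosed_setOf_polyFun_eq_zero ⟨MvPolynomial.aeval f P, fun _ => rfl⟩
  -- Each factor gives a relation on one of the three pieces, so the product gives one on their
  -- union.
  refine ⟨P₁ * (P₂ * P₃), mul_ne_zero hP₁ (mul_ne_zero hP₂ hP₃), mem_idealOf_iff.2 fun c hc => ?_⟩
  rw [nil2_eq_union] at hc
  simp only [map_mul, mul_eq_zero]
  refine hc.imp ?_ (Or.imp ?_ ?_)
  · exact fun hc => nil2k_subset_of_paramMap_mem (m := 2) (k := 3) (hcl P₁) h₁ hc
  · exact fun hc => nil2k_subset_of_paramMap_mem (m := 3) (k := 2) (hcl P₂) h₂ hc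
  · exact fun hc => nil2k_subset_of_paramMap_mem (m := 4) (k := 1) (hcl P₃) h₃ hc

theorem le_varietyDim_nil2 : 24 ≤ varietyDim (Nil2 5) := by
  have hcard : Fintype.card (Param 3 2) = 24 := by simp
  have := le_varietyDim (n := 3 + 2) (σ := Param 3 2) (F := paramMap) (V := Nil2 (3 + 2))
    isPolyFun_paramMap (fun y => (paramMap_mem y).1) (τ := Param 3 2)
    -- The 24 coordinates are the 18 entries of `w` and the first three coordinates of e₁e₁ and
    -- e₁e₂. The latter six are linear in `N`, with the matrix `W` formed by the rows `w 0 0` and `w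
    -- 0 1`.
    (Sum.elim (fun p => (Fin.castAdd 2 0, Fin.castAdd 2 (Fin.castSucc p.2), Fin.castAdd 2 p.1))
      fun p => (Fin.castAdd 2 p.1, Fin.castAdd 2 p.2.1, Fin.natAdd 3 p.2.2)) ?_
  · rw [hcard] at this
    exact this
  intro P hP
  set W : (Param 3 2 → ℂ) → Matrix (Fin 2) (Fin 2) ℂ := fun x =>
    Matrix.of fun d l => x (.inr (0, Fin.castSucc d, l))
  obtain ⟨q, hq⟩ : IsPolyFun fun x => (W x).det := .det fun d l => .coord _
  have hq₀ : q ≠ 0 := by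
    rintro rfl
    -- At this point `W` is the identity matrix.
    have := hq (Sum.elim 0 fun p => if p.2.1 = Fin.castSucc p.2.2 then 1 else 0)
    simp only [map_zero, Matrix.det_fin_two] at this
    simp [W] at this
  refine (mul_eq_zero.1 (MvPolynomial.funext fun x => ?_ : P * q = 0)).resolve_right hq₀
  rw [map_mul, map_zero, mul_eq_zero, hq]
  by_cases hdet : (W x).det = 0
  · exact .inr hdet
  · refine .inl ?_
    -- When `W` is invertible, solving for `N` row by row produces any prescribed values of the 24
    -- coordinates, so `P` vanishes wherever `q` does not.
    let y : Param 3 2 → ℂ := Sum.elim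
      (fun p => ((W x)⁻¹.mulVec fun d => x (.inl (p.1, d))) p.2) fun p => x (.inr p)
    have hy := hP y
    convert hy using 2
    congr 1
    funext a
    rcases a with ⟨i, d⟩ | ⟨i, j, l⟩
    · simp only [Sum.elim_inl]
      rw [paramMap_castAdd]
      have : (W x).mulVec ((W x)⁻¹.mulVec fun d => x (.inl (i, d))) = fun d => x (.inl (i, d)) := by
        rw [Matrix.mulVec_mulVec, Matrix.mul_nonsing_inv _ (Ne.isUnit hdet), Matrix.one_mulVec]
      exact (congrFun this d).symm
    · simp only [Sum.elim_inr]
      rw [paramMap_natAdd]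
      rfl

end Nil2Dim

end TwoStepNilpotent

theorem theoremB :
    -- the dimension of the variety
    varietyDim (Nil2 5) = 24 ∧
    -- its irreducible components, and their number
    components (Nil2 5) = {orbitClosure V23, orbitClosure V32, orbitClosure V41} ∧
    (components (Nil2 5)).ncard = 3 ∧
    -- the members of the three families have squares of dimension 3, 2, 1
    (∀ c ∈ V23, Module.finrank ℂ (square c) = 3) ∧
    (∀ c ∈ V32, Module.finrank ℂ (square c) = 2) ∧
    (∀ c ∈ V41, Module.finrank ℂ (square c) = 1) ∧
    -- the components are the closures of the loci where the square has dimension 3, 2, 1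
    orbitClosure V23 = closure {c | c ∈ Nil2 5 ∧ Module.finrank ℂ (square c) = 3} ∧
    orbitClosure V32 = closure {c | c ∈ Nil2 5 ∧ Module.finrank ℂ (square c) = 2} ∧
    orbitClosure V41 = closure {c | c ∈ Nil2 5 ∧ Module.finrank ℂ (square c) = 1} ∧
    -- the components are the sets given by `dim A² ≤ k ≤ dim Ann A`
    orbitClosure V23 = Nil2k 5 3 ∧
    orbitClosure V32 = Nil2k 5 2 ∧
    orbitClosure V41 = Nil2k 5 1 := by
  rw [orbitClosure_V23, orbitClosure_V32, orbitClosure_V41]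
  refine ⟨le_antisymm varietyDim_nil2_le le_varietyDim_nil2, components_nil2,
    ncard_components_nil2, fun _ => finrank_square_of_mem_V23, fun _ => finrank_square_of_mem_V32,
    fun _ => finrank_square_of_mem_V41, ?_, ?_, ?_, rfl, rfl, rfl⟩
  · rw [← orbitClosure_eq_closure orbitClosure_V23 fun _ => finrank_square_of_mem_V23,
      orbitClosure_V23]
  · rw [← orbitClosure_eq_closure orbitClosure_V32 fun _ => finrank_square_of_mem_V32,
      orbitClosure_V32]
  · rw [← orbitClosure_eq_closure orbitClosure_V41 fun _ => finrank_square_of_mem_V41,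
      orbitClosure_V41]
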